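/- **Setting.** Let $\mathbf{Set}^{\omega^{\mathrm{op}}}$ be the topos of trees: an object $X$ is a family of sets $(X_n)_{n\in\omega}$ with restriction maps $X_{n}\to X_m$ ($m\le n$). Products and coproducts are stagewise, $(Y^X)_n$ is the set of tuples $(f_i\colon X_i\to Y_i)_{i\le n}$ commuting with restrictions, $\mathcal P_\omega$ is the stagewise finite powerset functor, and $\triangleright$ is the later modality, $\triangleright_0X=1$, $\triangleright_{n+1}X=X_n$. *Syntax.* Programs of xNCCL are the closed terms of the grammar $p,q ::= S\mid K\mid I\mid S'(p)\mid K'(p)\mid S''(p,q)\mid p\,q\mid p\oplus q\mid p\parallel q$. Let $\Sigma$ be the corresponding polynomial functor, taken stagewise on $\mathbf{Set}^{\omega^{\mathrm{op}}}$; $\Sigma^\star X$ is the object of terms with variables in $X$ (stagewise), $\hat a\colon\Sigma^\star A\to A$ is term evaluation in a $\Sigma$-algebra $(A,a)$, and the initial algebra $(\mu\Sigma,\iota)$ is the constant presheaf of programs. Write $[\![-]\!]\colon\mu\Sigma\to A$ for the unique $\Sigma$-algebra morphism. *Rules.* The transitions $p\to p'$ and $p\xrightarrow{t}p'$ are generated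 by $S\xrightarrow{t}S'(t)$, $S'(p)\xrightarrow{t}S''(p,t)$, $S''(p,q)\xrightarrow{t}(p\,t)(q\,t)$, $K\xrightarrow{t}K'(t)$, $K'(p)\xrightarrow{t}p$, $I\xrightarrow{t}t$; if $p\to p'$ then $p\,q\to p'\,q$; if $p\xrightarrow{q}p'$ then $p\,q\to p'$; $p\oplus q\to p$ and $p\oplus q\to q$; if $p\to p'$ and $q\to q'$ then $p\parallel q\to p'\parallel q'$; if $p\xrightarrow{r}p'$ and $q\to q'$ then $p\parallel q\to p\parallel q'$; if $p\to p'$ and $q\xrightarrow{r}q'$ then $p\parallel q\to p'\parallel q$; if $p\xrightarrow{r}p'$ and $q\xrightarrow{s}q'$ then $p\parallel q\xrightarrow{t}p\,t\parallel q\,t$ for all $t$. *Behaviour.* Let $B(X,Y)=\mathcal P_\omega(\triangleright Y)+(\triangleright Y)^{\triangleright X}$. A higher-order coalgebra $z\colon Z\to B(Z,Z)$ is *locally final* if it is a final coalgebra of the endofunctor $B(Z,-)$. The rules are encoded by a higher-order GSOS law $\rho_{X,Y}\colon\Sigma(X\times B(X,Y))\to B(X,\Sigma^\star(X+Y))$,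 dinatural in $X$ and natural in $Y$. Here an argument $(p,b)\in X_n\times B_n(X,Y)$ of an operator is a formal program $p$, where $b=U\in\mathcal P_\omega(\triangleright_nY)$ lists its reducts and $b=f\in((\triangleright Y)^{\triangleright X})_n$ is its behaviour as a function. With all elements of $X_n$ restricted to the stage at which they are used, and every term read as the point $*$ at stage $0$ of $\triangleright$: $S,K,I,S'(p),K'(p),S''(p,q)$ are sent to the functions of $t$ given by the six rules for them; $(p,U)\,(q,\_)\mapsto\{p'\,q\mid p'\in U\}$; $(p,f)\,(q,\_)\mapsto\{f_n(q)\}$; $(p,\_)\oplus(q,\_)\mapsto\{p,q\}$; $(p,U)\parallel(q,V)\mapsto\{p'\parallel q'\mid p'\in U,q'\in V\}$; $(p,f)\parallel(q,V)\mapsto\{p\parallel q'\mid q'\in V\}$; $(p,U)\parallel(q,g)\mapsto\{p'\parallel q\mid p'\in U\}$; $(p,f)\parallel(q,g)\mapsto(t\mapsto p\,t\parallel q\,t)$. A *$\rho$-bialgebra* $(X,a\colon\Sigma X\to X,c\colon X\to B(X,X))$ satisfies $c\cdot a=B(\mathrm{id},\hat a\cdot\Sigma^\star\nabla)\cdot\rho_{X,X}\cdot\Sigma\langle\mathrm{id},c\rangle$.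 The *operational model* is the unique $\gamma\colon\mu\Sigma\to B(\mu\Sigma,\mu\Sigma)$ making $(\mu\Sigma,\iota,\gamma)$ a $\rho$-bialgebra. A *denotational model* is a $\rho$-bialgebra whose higher-order coalgebra is locally final. Let $\mathsf{beh}\colon(\mu\Sigma,\gamma)\to\nu B(\mu\Sigma,-)$ be the unique coalgebra morphism into the final $B(\mu\Sigma,-)$-coalgebra. A $\Sigma$-algebra $(A,a)$ is *adequate* if $\mathsf{beh}=e\cdot[\![-]\!]$ for some $e\colon A\to\nu B(\mu\Sigma,-)$. *Bisimilarity.* Step-indexed strong applicative bisimilarity is behavioural equivalence: $p$ and $q$ are equivalent at stage $n$ if $\mathsf{beh}_n(p)=\mathsf{beh}_n(q)$. In relational form, let $(\sim_n)_{n\in\omega}$ be the greatest family of equivalence relations on programs such that $p\sim_{n+1}q$ implies: $p\sim_nq$; if $p\to p'$ then $q\to q'$ for some $q'$ with $p'\sim_nq'$; if $p\xrightarrow{t}p'$ then $q\xrightarrow{t}q'$ for some $q'$ with $p'\sim_nq'$. **Theorem (Denotational model for xNCCL).** 1. $B$ has a locally final coalgebra; moreover $B(X,-)$ has a final coalgebra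 for every $X$. 2. Every locally final coalgebra $(Z,z)$ of $B$ extends to a denotational model $\Sigma Z\xrightarrow{a}Z\xrightarrow{z}B(Z,Z)$ of $\rho$. 3. Every denotational model $(Z,a,z)$ is adequate, and for all programs $p,q$ and all $n\in\omega$, $[\![p]\!]_n=[\![q]\!]_n$ implies $\mathsf{beh}_n(p)=\mathsf{beh}_n(q)$ and $p\sim_nq$. 4. For all programs $p,q$ and $n\in\omega$: $\mathsf{beh}_n(p)=\mathsf{beh}_n(q)$ if and only if $p\sim_{n+1}q$. -/

import Mathlib

open CategoryTheory CategoryTheory.Limits Opposite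

namespace XNCCL

/-! ## Higher-order coalgebras -/

section HigherOrderCoalgebras

universe v u

/-- A higher-order coalgebra `z : Z ⟶ B(Z, Z)` of a mixed-variance bifunctor is *locally final*
if it is a final coalgebra of the endofunctor `B(Z, -)`. -/
def IsLocallyFinal {C : Type u} [Category.{v} C] (B : Cᵒᵖ ⥤ C ⥤ C) (Z : C)
    (z : Z ⟶ (B.obj (op Z)).obj Z) : Prop :=
  Nonempty (IsTerminal (⟨Z, z⟩ : Endofunctor.Coalgebra (B.obj (op Z))))

end HigherOrderCoalgebras

/-! ## The topos of trees -/

/-- The topos of trees: presheaves on the poset `ω = {0 < 1 < 2 < ...}`. -/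
abbrev Tree := ℕᵒᵖ ⥤ Type

/-- The restriction map `X_n → X_m` for `m ≤ n`. -/
def res (X : Tree) {m n : ℕ} (h : m ≤ n) (x : X.obj (op n)) : X.obj (op m) :=
  X.map (homOfLE h).op x

theorem res_self (X : Tree) {n : ℕ} (h : n ≤ n) (x : X.obj (op n)) : res X h x = x := by
  simp [res]

theorem res_res (X : Tree) {k m n : ℕ} (h : k ≤ m) (h' : m ≤ n) (x : X.obj (op n)) :
    res X h (res X h' x) = res X (h.trans h') x := by
  have : (homOfLE (h.trans h')).op = (homOfLE h').op ≫ (homOfLE h).op := rfl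
  simp [res, this]

theorem app_res {X Y : Tree} (f : X ⟶ Y) {m n : ℕ} (h : m ≤ n) (x : X.obj (op n)) :
    f.app (op m) (res X h x) = res Y h (f.app (op n) x) :=
  NatTrans.naturality_apply f (homOfLE h).op x

theorem map_eq_res (X : Tree) {a b : ℕᵒᵖ} (f : a ⟶ b) (x : X.obj a) :
    X.map f x = res X (leOfHom f.unop) x := rfl

/-- A tree given by its stages and restriction maps. -/
abbrev mkTree (o : ℕ → Type) (r : ∀ {m n : ℕ}, m ≤ n → o n → o m)
    (r_self : ∀ {n : ℕ} (x : o n), r (le_refl n) x = x)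
    (r_trans : ∀ {k m n : ℕ} (h : k ≤ m) (h' : m ≤ n) (x : o n),
      r h (r h' x) = r (h.trans h') x) : Tree where
  obj a := o a.unop
  map f := ↾(r (leOfHom f.unop))
  map_id _ := by ext x; exact r_self x
  map_comp f g := by
    ext x; exact (r_trans (leOfHom g.unop) (leOfHom f.unop) x).symm

/-- A morphism of trees given by maps that commute with restriction. -/
abbrev mkHom {X Y : Tree} (f : ∀ n, X.obj (op n) → Y.obj (op n))
    (nat : ∀ {m n : ℕ} (h : m ≤ n) (x : X.obj (op n)), f m (res X h x) = res Y h (f n x)) :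
    X ⟶ Y where
  app a := ↾(f a.unop)
  naturality a b g := by
    ext x; exact nat (leOfHom g.unop) x

theorem hom_ext {X Y : Tree} {f g : X ⟶ Y}
    (h : ∀ n (x : X.obj (op n)), f.app (op n) x = g.app (op n) x) : f = g := by
  ext a x; exact h a.unop x

/-- The binary product of trees (computed stagewise). -/
abbrev prodT (X Y : Tree) : Tree := FunctorToTypes.prod X Y

/-- The binary coproduct of trees (computed stagewise). -/
abbrev sumT (X Y : Tree) : Tree := FunctorToTypes.coprod X Y

/-- `f × g` for morphisms of trees. -/
def prodMap {X X' Y Y' : Tree} (f : X ⟶ X') (g : Y ⟶ Y') : prodT X Y ⟶ prodT X' Y' :=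
  FunctorToTypes.prod.lift (FunctorToTypes.prod.fst ≫ f) (FunctorToTypes.prod.snd ≫ g)

/-- `f + g` for morphisms of trees. -/
def sumMap {X X' Y Y' : Tree} (f : X ⟶ X') (g : Y ⟶ Y') : sumT X Y ⟶ sumT X' Y' :=
  FunctorToTypes.coprod.desc (f ≫ FunctorToTypes.coprod.inl) (g ≫ FunctorToTypes.coprod.inr)

/-- The codiagonal `∇ : X + X ⟶ X`. -/
def codiag (X : Tree) : sumT X X ⟶ X := FunctorToTypes.coprod.desc (𝟙 X) (𝟙 X)

/-! ### The later modality -/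

/-- The stages of `▷X`: the one-point set at stage `0` and `X_n` at stage `n + 1`. -/
def LaterObj (X : Tree) : ℕ → Type
  | 0 => PUnit
  | n + 1 => X.obj (op n)

instance (X : Tree) : Subsingleton (LaterObj X 0) := inferInstanceAs (Subsingleton PUnit)

/-- The restriction maps of `▷X`. -/
def laterRes (X : Tree) : ∀ {m n : ℕ}, m ≤ n → LaterObj X n → LaterObj X m
  | 0, _, _, _ => PUnit.unit
  | _ + 1, _ + 1, h, x => res X (Nat.le_of_succ_le_succ h) x

/-- The action of the later modality on morphisms, at each stage. -/
def laterApp {X Y : Tree} (f : X ⟶ Y) : ∀ n : ℕ, LaterObj X n → LaterObj Y n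
  | 0, _ => PUnit.unit
  | n + 1, x => f.app (op n) x

/-- The later modality `▷` on the topos of trees. -/
def later : Tree ⥤ Tree where
  obj X := mkTree (LaterObj X) (laterRes X)
    (by
      rintro (_ | n) x
      · rfl
      · exact res_self X _ x)
    (by
      rintro (_ | k) (_ | m) (_ | n) h h' x
      · rfl
      · rfl
      · rfl
      · rfl
      · omega
      · omega
      · omega
      · exact res_res X _ _ x)
  map f := mkHom (laterApp f) (by
    rintro (_ | m) (_ | n) h x
    · rfl
    · rfl
    · omega
    · exact app_res f _ x)
  map_id X := hom_ext (by rintro (_ | n) x <;> rfl)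
  map_comp f g := hom_ext (by rintro (_ | n) x <;> rfl)

/-- The canonical map `X_n → ▷_n X`, given by restriction. -/
def next (X : Tree) : ∀ n : ℕ, X.obj (op n) → LaterObj X n
  | 0, _ => PUnit.unit
  | n + 1, x => res X (Nat.le_succ n) x

/-- Stagewise application of a unary family of maps under the later modality. -/
def later₁ {A C : Tree} (f : ∀ i, A.obj (op i) → C.obj (op i)) :
    ∀ n : ℕ, LaterObj A n → LaterObj C n
  | 0, _ => PUnit.unit
  | i + 1, a => f i a

/-- Stagewise application of a binary family of maps under the later modality. -/
def later₂ {A B C : Tree} (f : ∀ i, A.obj (op i) → B.obj (op i) → C.obj (op i)) :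
    ∀ n : ℕ, LaterObj A n → LaterObj B n → LaterObj C n
  | 0, _, _ => PUnit.unit
  | i + 1, a, b => f i a b

/-! ### Exponentials -/

/-- Stage `n` of the exponential `Y^X`: tuples `(f_i : X_i → Y_i)_{i ≤ n}` of maps that commute
with restriction. -/
@[ext]
structure Exp (X Y : Tree) (n : ℕ) where
  app : ∀ i, i ≤ n → X.obj (op i) → Y.obj (op i)
  nat : ∀ {i j : ℕ} (hji : j ≤ i) (hi : i ≤ n) (x : X.obj (op i)),
    res Y hji (app i hi x) = app j (hji.trans hi) (res X hji x)

/-- Restriction of tuples `(f_i)_{i ≤ n}` to `(f_i)_{i ≤ m}`. -/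
def Exp.restrict {X Y : Tree} {m n : ℕ} (h : m ≤ n) (f : Exp X Y n) : Exp X Y m where
  app i hi := f.app i (hi.trans h)
  nat hji hi x := f.nat hji (hi.trans h) x

/-- The functorial action of exponentials, contravariant in the exponent. -/
def Exp.map {X X' Y Y' : Tree} (a : X' ⟶ X) (b : Y ⟶ Y') {n : ℕ} (f : Exp X Y n) :
    Exp X' Y' n where
  app i hi x := b.app (op i) (f.app i hi (a.app (op i) x))
  nat hji hi x := by rw [← app_res, f.nat, app_res]

/-- The exponential bifunctor `(X, Y) ↦ Y^X` on the topos of trees. -/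
def expF : Treeᵒᵖ ⥤ Tree ⥤ Tree where
  obj X :=
    { obj := fun Y => mkTree (Exp X.unop Y) Exp.restrict (fun _ => rfl) (fun _ _ _ => rfl)
      map := fun g => mkHom (fun _ => Exp.map (𝟙 X.unop) g) (fun _ _ => rfl)
      map_id := fun _ => hom_ext (fun _ _ => rfl)
      map_comp := fun _ _ => hom_ext (fun _ _ => rfl) }
  map f :=
    { app := fun Y => mkHom (fun _ => Exp.map f.unop (𝟙 Y)) (fun _ _ => rfl)
      naturality := fun _ _ _ => hom_ext (fun _ _ => rfl) }
  map_id _ := by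
    ext Y : 2
    exact hom_ext (fun _ _ => rfl)
  map_comp _ _ := by
    ext Y : 2
    exact hom_ext (fun _ _ => rfl)

/-! ### Finite powersets -/

/-- The set of finite subsets of `α`. -/
abbrev Pow (α : Type) : Type := {s : Set α // s.Finite}

/-- Direct images of finite subsets. -/
def Pow.map {α β : Type} (f : α → β) (U : Pow α) : Pow β := ⟨f '' U.1, U.2.image f⟩

/-- Direct images of pairs of finite subsets under a binary map. -/
def Pow.map₂ {α β γ : Type} (f : α → β → γ) (U : Pow α) (V : Pow β) : Pow γ :=
  ⟨Set.image2 f U.1 V.1, U.2.image2 f V.2⟩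

/-- The subset `{a, b}`. -/
def Pow.pair {α : Type} (a b : α) : Pow α := ⟨{a, b}, Set.toFinite _⟩

/-- The subset `{a}`. -/
def Pow.single {α : Type} (a : α) : Pow α := ⟨{a}, Set.toFinite _⟩

theorem Pow.map_single {α β : Type} (f : α → β) (a : α) :
    Pow.map f (Pow.single a) = Pow.single (f a) :=
  Subtype.ext Set.image_singleton

theorem Pow.map_square {α β β' γ : Type} {f : α → β} {g : β → γ} {f' : α → β'} {g' : β' → γ}
    (h : ∀ a, g (f a) = g' (f' a)) (U : Pow α) :
    Pow.map g (Pow.map f U) = Pow.map g' (Pow.map f' U) :=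
  Subtype.ext (by
    change g '' (f '' U.1) = g' '' (f' '' U.1)
    rw [Set.image_image, Set.image_image]
    exact Set.image_congr fun a _ => h a)

theorem Pow.map_pair {α β : Type} (f : α → β) (a b : α) :
    Pow.map f (Pow.pair a b) = Pow.pair (f a) (f b) :=
  Subtype.ext (Set.image_pair f a b)

theorem Pow.map₂_square {α α' β β' γ γ' : Type} {f : α → β → γ} {g : γ → γ'}
    {f' : α' → β' → γ'} {a : α → α'} {b : β → β'} (h : ∀ u v, f' (a u) (b v) = g (f u v))
    (U : Pow α) (V : Pow β) :
    Pow.map₂ f' (Pow.map a U) (Pow.map b V) = Pow.map g (Pow.map₂ f U V) :=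
  Subtype.ext (by
    change Set.image2 f' (a '' U.1) (b '' V.1) = g '' Set.image2 f U.1 V.1
    rw [Set.image2_image_left, Set.image2_image_right, Set.image_image2]
    exact Set.image2_congr fun u _ v _ => h u v)

theorem Pow.map_triangle {α β γ : Type} {f : α → β} {g : β → γ} {g' : α → γ}
    (h : ∀ a, g (f a) = g' a) (U : Pow α) : Pow.map g (Pow.map f U) = Pow.map g' U :=
  Subtype.ext (by
    change g '' (f '' U.1) = g' '' U.1
    rw [Set.image_image]
    exact Set.image_congr fun a _ => h a)

theorem Pow.map₂_triangle {α β γ γ' : Type} {f : α → β → γ} {g : γ → γ'} {f' : α → β → γ'}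
    (h : ∀ u v, g (f u v) = f' u v) (U : Pow α) (V : Pow β) :
    Pow.map g (Pow.map₂ f U V) = Pow.map₂ f' U V :=
  Subtype.ext (by
    change g '' Set.image2 f U.1 V.1 = Set.image2 f' U.1 V.1
    rw [Set.image_image2]
    exact Set.image2_congr fun u _ v _ => h u v)

/-- The finite powerset functor on sets. -/
def powType : Type ⥤ Type where
  obj := Pow
  map f := ↾(Pow.map f)
  map_id α := by
    refine ConcreteCategory.hom_ext _ _ fun U => ?_
    exact Subtype.ext (Set.image_id U.1)
  map_comp f g := by
    refine ConcreteCategory.hom_ext _ _ fun U => ?_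
    exact Subtype.ext (Set.image_comp g f U.1)

/-- The stagewise finite powerset functor on the topos of trees. -/
def powF : Tree ⥤ Tree := (Functor.whiskeringRight ℕᵒᵖ Type Type).obj powType

/-! ### The behaviour bifunctor -/

/-- The behaviour bifunctor `B(X, Y) = 𝒫_ω(▷Y) + (▷Y)^(▷X)` of xNCCL. -/
def Bnc : Treeᵒᵖ ⥤ Tree ⥤ Tree where
  obj X :=
    { obj := fun Y => sumT (powF.obj (later.obj Y))
        ((expF.obj (op (later.obj X.unop))).obj (later.obj Y))
      map := fun g => sumMap (powF.map (later.map g))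
        ((expF.obj (op (later.obj X.unop))).map (later.map g))
      map_id := fun Y => by
        simp only [CategoryTheory.Functor.map_id]
        exact hom_ext (fun n x => by rcases x with x | x <;> rfl)
      map_comp := fun g g' => by
        simp only [Functor.map_comp]
        exact hom_ext (fun n x => by rcases x with x | x <;> rfl) }
  map f :=
    { app := fun Y => sumMap (𝟙 _) ((expF.map (later.map f.unop).op).app (later.obj Y))
      naturality := fun _ _ _ => hom_ext (fun n x => by rcases x with x | x <;> rfl) }
  map_id X := by
    ext Y : 2
    simp only [unop_id, CategoryTheory.Functor.map_id]
    exact hom_ext (fun n x => by rcases x with x | x <;> rfl)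
  map_comp f g := by
    ext Y : 2
    simp only [unop_comp, Functor.map_comp, op_comp]
    exact hom_ext (fun n x => by rcases x with x | x <;> rfl)

/-! ## Syntax -/

/-- The polynomial functor of the signature of xNCCL on sets: constants `S`, `K`, `I`, the auxiliary
operators `S'`, `K'` (unary) and `S''` (binary), written `S₁`, `K₁`, `S₂` here, application,
non-deterministic choice and parallel composition. -/
inductive Sig (X : Type) : Type
  | S : Sig X
  | K : Sig X
  | I : Sig X
  | S₁ (p : X) : Sig X
  | K₁ (p : X) : Sig X
  | S₂ (p q : X) : Sig X
  | app (p q : X) : Sig X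
  | choice (p q : X) : Sig X
  | par (p q : X) : Sig X

/-- Functorial action of the signature. -/
def Sig.map {X Y : Type} (f : X → Y) : Sig X → Sig Y
  | .S => .S
  | .K => .K
  | .I => .I
  | .S₁ p => .S₁ (f p)
  | .K₁ p => .K₁ (f p)
  | .S₂ p q => .S₂ (f p) (f q)
  | .app p q => .app (f p) (f q)
  | .choice p q => .choice (f p) (f q)
  | .par p q => .par (f p) (f q)

/-- The signature as a functor on sets. -/
def sigType : Type ⥤ Type where
  obj := Sig
  map f := ↾(Sig.map f)
  map_id _ := ConcreteCategory.hom_ext _ _ fun s => by cases s <;> rfl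
  map_comp _ _ := ConcreteCategory.hom_ext _ _ fun s => by cases s <;> rfl

/-- The syntax functor `Σ` on the topos of trees, computed stagewise. -/
def sigF : Tree ⥤ Tree := (Functor.whiskeringRight ℕᵒᵖ Type Type).obj sigType

/-- Terms over the signature with variables from `V`. -/
inductive Term (V : Type) : Type
  | var (v : V) : Term V
  | S : Term V
  | K : Term V
  | I : Term V
  | S₁ (p : Term V) : Term V
  | K₁ (p : Term V) : Term V
  | S₂ (p q : Term V) : Term V
  | app (p q : Term V) : Term V
  | choice (p q : Term V) : Term V
  | par (p q : Term V) : Term V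

namespace Term

/-- The structure of the term algebra. -/
def mk {V : Type} : Sig (Term V) → Term V
  | .S => S
  | .K => K
  | .I => I
  | .S₁ p => S₁ p
  | .K₁ p => K₁ p
  | .S₂ p q => S₂ p q
  | .app p q => app p q
  | .choice p q => choice p q
  | .par p q => par p q

/-- The unique extension of `h : V → A` to a homomorphism from the term algebra to `(A, a)`. -/
def fold {V A : Type} (h : V → A) (a : Sig A → A) : Term V → A
  | var v => h v
  | S => a .S
  | K => a .K
  | I => a .I
  | S₁ p => a (.S₁ (p.fold h a))
  | K₁ p => a (.K₁ (p.fold h a))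
  | S₂ p q => a (.S₂ (p.fold h a) (q.fold h a))
  | app p q => a (.app (p.fold h a) (q.fold h a))
  | choice p q => a (.choice (p.fold h a) (q.fold h a))
  | par p q => a (.par (p.fold h a) (q.fold h a))

/-- Renaming of variables. -/
def map {V W : Type} (f : V → W) : Term V → Term W := fold (fun v => var (f v)) mk

theorem fold_mk {V A : Type} (h : V → A) (a : Sig A → A) (s : Sig (Term V)) :
    fold h a (mk s) = a (s.map (fold h a)) := by
  cases s <;> rfl

theorem fold_unique {V A : Type} (h : V → A) (a : Sig A → A) (k : Term V → A)
    (hv : ∀ v, k (var v) = h v) (hm : ∀ s, k (mk s) = a (s.map k)) (t : Term V) :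
    k t = fold h a t := by
  induction t with
  | var v => exact hv v
  | S => exact hm .S
  | K => exact hm .K
  | I => exact hm .I
  | S₁ p ih => exact (hm (.S₁ p)).trans (by simp only [Sig.map, fold, ih])
  | K₁ p ih => exact (hm (.K₁ p)).trans (by simp only [Sig.map, fold, ih])
  | S₂ p q ih ih' => exact (hm (.S₂ p q)).trans (by simp only [Sig.map, fold, ih, ih'])
  | app p q ih ih' => exact (hm (.app p q)).trans (by simp only [Sig.map, fold, ih, ih'])
  | choice p q ih ih' => exact (hm (.choice p q)).trans (by simp only [Sig.map, fold, ih, ih'])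
  | par p q ih ih' => exact (hm (.par p q)).trans (by simp only [Sig.map, fold, ih, ih'])

theorem comp_fold {V A A' : Type} (h : V → A) (a : Sig A → A) (a' : Sig A' → A') (k : A → A')
    (hk : ∀ s, k (a s) = a' (s.map k)) (t : Term V) :
    k (fold h a t) = fold (fun v => k (h v)) a' t := by
  induction t with
  | var v => rfl
  | _ => simp_all [fold, Sig.map]

theorem map_id' {V : Type} (t : Term V) : map (fun v => v) t = t :=
  (fold_unique _ _ (fun t => t) (fun _ => rfl) (fun s => by cases s <;> rfl) t).symm

theorem map_map {U V W : Type} (f : U → V) (g : V → W) (t : Term U) :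
    map g (map f t) = map (fun u => g (f u)) t :=
  comp_fold _ _ _ (map g) (fun s => by cases s <;> rfl) t

end Term

/-- The term functor on sets. -/
def termType : Type ⥤ Type where
  obj := Term
  map f := ↾(Term.map f)
  map_id V := ConcreteCategory.hom_ext (X := (Term V : Type)) _ _ fun (t : Term _) => Term.map_id' t
  map_comp {U _ W} f g := ConcreteCategory.hom_ext (X := (Term U : Type)) (Y := (Term W : Type)) _ _
    fun t => (Term.map_map f g t).symm

/-- The free monad `Σ⋆` on the topos of trees as a functor: at each stage, terms with variables
from that stage. -/
def termF : Tree ⥤ Tree := (Functor.whiskeringRight ℕᵒᵖ Type Type).obj termType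

/-- The evaluation `Σ⋆ A ⟶ A` of terms in a `Σ`-algebra, i.e. the induced Eilenberg-Moore
algebra. -/
def evalT {A : Tree} (a : sigF.obj A ⟶ A) : termF.obj A ⟶ A :=
  mkHom (fun n => Term.fold id (a.app (op n))) (fun {m n} h t => by
    refine Eq.trans (Term.comp_fold (fun v => Term.var (res A h v)) Term.mk (a.app (op m))
      (Term.fold id (a.app (op m))) (fun s => Term.fold_mk _ _ s) t) ?_
    exact (Term.comp_fold id (a.app (op n)) (a.app (op m)) (res A h)
      (fun s => (app_res a h s).symm) t).symm)

/-- Closed terms, i.e. programs. -/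
abbrev Prog : Type := Term Empty

/-- The constant presheaf of closed terms, as a `Σ`-algebra `ι : Σ(μΣ) ⟶ μΣ`. -/
def muSig : Endofunctor.Algebra sigF where
  a := (Functor.const ℕᵒᵖ).obj Prog
  str := mkHom (fun _ => Term.mk) (fun _ s => by cases s <;> rfl)

/-- `(μΣ, ι)` is the initial `Σ`-algebra. -/
def muSigInitial : IsInitial muSig :=
  IsInitial.ofUniqueHom
    (fun A =>
      { f := mkHom (fun n => Term.fold Empty.elim (A.str.app (op n))) (fun {m n} h t => by
          refine Eq.trans ?_ (Term.comp_fold Empty.elim (A.str.app (op n)) (A.str.app (op m))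
            (res A.a h) (fun s => (app_res A.str h s).symm) t).symm
          exact congrArg (fun e => Term.fold e (A.str.app (op m)) t) (funext fun e => e.elim))
        h := hom_ext fun n s => (Term.fold_mk _ _ s).symm })
    (fun A g => by
      apply Endofunctor.Algebra.ext
      refine hom_ext fun n t => ?_
      refine Term.fold_unique _ _ (g.f.app (op n)) (fun e => e.elim) (fun s => ?_) t
      exact (ConcreteCategory.congr_hom (NatTrans.congr_app g.h (op n)) s).symm)

/-- The denotation map `⟦-⟧ : μΣ ⟶ A`, i.e. the unique `Σ`-algebra morphism into `(A, a)`. -/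
def sem {A : Tree} (a : sigF.obj A ⟶ A) : muSig.a ⟶ A :=
  (muSigInitial.to ⟨A, a⟩).f

/-- Primitive recursion: the unique `g : μΣ ⟶ P` with `g ∘ ι = s ∘ Σ⟨id, g⟩`. -/
def primRec {P : Tree} (s : sigF.obj (prodT muSig.a P) ⟶ P) : muSig.a ⟶ P :=
  (muSigInitial.to ⟨prodT muSig.a P,
    FunctorToTypes.prod.lift (sigF.map FunctorToTypes.prod.fst ≫ muSig.str) s⟩).f ≫
    FunctorToTypes.prod.snd

theorem primRec_spec {P : Tree} (s : sigF.obj (prodT muSig.a P) ⟶ P) :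
    muSig.str ≫ primRec s =
      sigF.map (FunctorToTypes.prod.lift (𝟙 muSig.a) (primRec s)) ≫ s := by
  obtain ⟨f, h, hf⟩ : ∃ f : muSig.a ⟶ prodT muSig.a P,
      sigF.map f ≫ FunctorToTypes.prod.lift (sigF.map FunctorToTypes.prod.fst ≫ muSig.str) s =
        muSig.str ≫ f ∧ primRec s = f ≫ FunctorToTypes.prod.snd :=
    ⟨_, Endofunctor.Algebra.Hom.h _, rfl⟩
  have h1 : f ≫ FunctorToTypes.prod.fst = 𝟙 muSig.a := by
    let k : muSig ⟶ muSig :=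
      { f := f ≫ FunctorToTypes.prod.fst
        h := by
          rw [Functor.map_comp, Category.assoc, ← Category.assoc muSig.str, ← h]
          rfl }
    exact congrArg Endofunctor.Algebra.Hom.f (muSigInitial.hom_ext k (𝟙 _))
  have h2 : FunctorToTypes.prod.lift (𝟙 muSig.a) (primRec s) = f := by
    rw [← h1, hf]; rfl
  rw [h2, hf, ← Category.assoc, ← h]
  rfl

theorem primRec_unique {P : Tree} (s : sigF.obj (prodT muSig.a P) ⟶ P) (g : muSig.a ⟶ P)
    (hg : muSig.str ≫ g = sigF.map (FunctorToTypes.prod.lift (𝟙 muSig.a) g) ≫ s) :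
    g = primRec s := by
  have e : sigF.map (FunctorToTypes.prod.lift (𝟙 muSig.a) g) ≫
      FunctorToTypes.prod.lift (sigF.map FunctorToTypes.prod.fst ≫ muSig.str) s =
      muSig.str ≫ FunctorToTypes.prod.lift (𝟙 muSig.a) g := by
    have e1 : muSig.str ≫ FunctorToTypes.prod.lift (𝟙 muSig.a) g =
        FunctorToTypes.prod.lift muSig.str (muSig.str ≫ g) := rfl
    have e2 : sigF.map (FunctorToTypes.prod.lift (𝟙 muSig.a) g) ≫
        FunctorToTypes.prod.lift (sigF.map FunctorToTypes.prod.fst ≫ muSig.str) s =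
        FunctorToTypes.prod.lift
          (sigF.map (FunctorToTypes.prod.lift (𝟙 muSig.a) g) ≫
            sigF.map FunctorToTypes.prod.fst ≫ muSig.str)
          (sigF.map (FunctorToTypes.prod.lift (𝟙 muSig.a) g) ≫ s) := rfl
    rw [e1, e2, ← Functor.map_comp_assoc, FunctorToTypes.prod.lift_fst,
      CategoryTheory.Functor.map_id, Category.id_comp, hg]
  let k : muSig ⟶ ⟨prodT muSig.a P,
      FunctorToTypes.prod.lift (sigF.map FunctorToTypes.prod.fst ≫ muSig.str) s⟩ :=
    { f := FunctorToTypes.prod.lift (𝟙 muSig.a) g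
      h := e }
  have hk : FunctorToTypes.prod.lift (𝟙 muSig.a) g = (muSigInitial.to ⟨prodT muSig.a P,
      FunctorToTypes.prod.lift (sigF.map FunctorToTypes.prod.fst ≫ muSig.str) s⟩).f :=
    congrArg Endofunctor.Algebra.Hom.f (muSigInitial.hom_ext k (muSigInitial.to _))
  have e3 : FunctorToTypes.prod.lift (𝟙 muSig.a) g ≫ FunctorToTypes.prod.snd = g := rfl
  exact e3.symm.trans (congrArg (fun f => f ≫ FunctorToTypes.prod.snd) hk)

/-! ## Higher-order GSOS laws and their models -/

/-- A higher-order GSOS law of `Σ` over a bifunctor `B` on the topos of trees: a family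
`ρ_{X,Y} : Σ(X × B(X, Y)) ⟶ B(X, Σ⋆(X + Y))` dinatural in `X` and natural in `Y`. -/
structure HOGSOSLaw (B : Treeᵒᵖ ⥤ Tree ⥤ Tree) where
  app : ∀ X Y : Tree, sigF.obj (prodT X ((B.obj (op X)).obj Y)) ⟶
    (B.obj (op X)).obj (termF.obj (sumT X Y))
  natural : ∀ (X : Tree) {Y Y' : Tree} (g : Y ⟶ Y'),
    sigF.map (prodMap (𝟙 X) ((B.obj (op X)).map g)) ≫ app X Y' =
      app X Y ≫ (B.obj (op X)).map (termF.map (sumMap (𝟙 X) g))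
  dinatural : ∀ {X X' : Tree} (h : X ⟶ X') (Y : Tree),
    sigF.map (prodMap (𝟙 X) ((B.map h.op).app Y)) ≫ app X Y ≫
        (B.obj (op X)).map (termF.map (sumMap h (𝟙 Y))) =
      sigF.map (prodMap h (𝟙 ((B.obj (op X')).obj Y))) ≫ app X' Y ≫
        (B.map h.op).app (termF.obj (sumT X' Y))

namespace HOGSOSLaw

variable {B : Treeᵒᵖ ⥤ Tree ⥤ Tree} (ρ : HOGSOSLaw B)

/-- The composite `B(id, â ∘ Σ⋆∇) ∘ ρ_{X,X} : Σ(X × B(X, X)) ⟶ B(X, X)` for a `Σ`-algebra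
`(X, a)`. -/
def step {X : Tree} (a : sigF.obj X ⟶ X) :
    sigF.obj (prodT X ((B.obj (op X)).obj X)) ⟶ (B.obj (op X)).obj X :=
  ρ.app X X ≫ (B.obj (op X)).map (termF.map (codiag X) ≫ evalT a)

/-- `(X, a, c)` is a `ρ`-bialgebra. -/
def IsBialgebra (X : Tree) (a : sigF.obj X ⟶ X) (c : X ⟶ (B.obj (op X)).obj X) : Prop :=
  a ≫ c = sigF.map (FunctorToTypes.prod.lift (𝟙 X) c) ≫ ρ.step a

/-- A denotational model: a `ρ`-bialgebra whose higher-order coalgebra is locally final. -/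
def IsDenotationalModel (Z : Tree) (a : sigF.obj Z ⟶ Z) (z : Z ⟶ (B.obj (op Z)).obj Z) : Prop :=
  ρ.IsBialgebra Z a z ∧ IsLocallyFinal B Z z

/-- The operational model `γ : μΣ ⟶ B(μΣ, μΣ)` of `ρ`, defined by primitive recursion. -/
def opModel : muSig.a ⟶ (B.obj (op muSig.a)).obj muSig.a :=
  primRec (ρ.step muSig.str)

/-- The operational model satisfies its defining diagram. -/
theorem opModel_isBialgebra : ρ.IsBialgebra muSig.a muSig.str ρ.opModel :=
  primRec_spec _

/-- The defining diagram determines the operational model. -/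
theorem opModel_unique (c : muSig.a ⟶ (B.obj (op muSig.a)).obj muSig.a)
    (hc : ρ.IsBialgebra muSig.a muSig.str c) : c = ρ.opModel :=
  primRec_unique _ c hc

/-- The operational model as a coalgebra for `B(μΣ, -)`. -/
def opCoalg : Endofunctor.Coalgebra (B.obj (op muSig.a)) := ⟨muSig.a, ρ.opModel⟩

/-- The behaviour map `beh : μΣ ⟶ ν B(μΣ, -)` into a given final `B(μΣ, -)`-coalgebra. -/
def beh {T : Endofunctor.Coalgebra (B.obj (op muSig.a))} (hT : IsTerminal T) : muSig.a ⟶ T.V :=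
  (hT.from ρ.opCoalg).f

/-- A `Σ`-algebra `(A, a)` is adequate if `beh` factorizes through `⟦-⟧ : μΣ ⟶ A`. -/
def IsAdequate (A : Tree) (a : sigF.obj A ⟶ A) : Prop :=
  ∀ (T : Endofunctor.Coalgebra (B.obj (op muSig.a))) (hT : IsTerminal T),
    ∃ e : A ⟶ T.V, sem a ≫ e = ρ.beh hT

/-- Stage-`n` behavioural equivalence of programs with respect to the final
`B(μΣ, -)`-coalgebra. -/
def BehEquiv (n : ℕ) (p q : Prog) : Prop :=
  ∀ (T : Endofunctor.Coalgebra (B.obj (op muSig.a))) (hT : IsTerminal T),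
    (ρ.beh hT).app (op n) p = (ρ.beh hT).app (op n) q

end HOGSOSLaw

/-! ## The higher-order GSOS law of xNCCL -/

section Rho

/-- A variable from `X` as a term over `X + Y`. -/
abbrev tx {A C : Type} (p : A) : Term (A ⊕ C) := .var (.inl p)

/-- A variable from `Y` as a term over `X + Y`. -/
abbrev ty {A C : Type} (p : C) : Term (A ⊕ C) := .var (.inr p)

/-- A tuple of maps `▷_i X → ▷_i C` (`i ≤ n`), given for `i = j + 1` by the map `k j`. -/
def lam {X C : Tree} {n : ℕ} (k : ∀ j, j < n → X.obj (op j) → C.obj (op j))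
    (hk : ∀ {i j : ℕ} (hji : j ≤ i) (hi : i < n) (t : X.obj (op i)),
      res C hji (k i hi t) = k j (lt_of_le_of_lt hji hi) (res X hji t)) :
    Exp (later.obj X) (later.obj C) n where
  app
    | 0, _, _ => PUnit.unit
    | j + 1, hj, t => k j hj t
  nat := by
    rintro (_ | i) (_ | j) hji hi t
    · rfl
    · omega
    · rfl
    · exact hk (Nat.le_of_succ_le_succ hji) hi t

/-- The operational rules of xNCCL, as a map
`Σ(X × B(X, Y))_n → B(X, Σ⋆(X + Y))_n` at each stage `n`. -/
def rhoFun (X Y : Tree) (n : ℕ) :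
    Sig (X.obj (op n) × (Pow (LaterObj Y n) ⊕ Exp (later.obj X) (later.obj Y) n)) →
      Pow (LaterObj (termF.obj (sumT X Y)) n) ⊕
        Exp (later.obj X) (later.obj (termF.obj (sumT X Y))) n
  | .S => .inr (lam (fun _ _ t => .S₁ (tx t)) (fun _ _ _ => rfl))
  | .K => .inr (lam (fun _ _ t => .K₁ (tx t)) (fun _ _ _ => rfl))
  | .I => .inr (lam (fun _ _ t => tx t) (fun _ _ _ => rfl))
  | .S₁ (p, _) => .inr (lam (fun _ h t => .S₂ (tx (res X h.le p)) (tx t))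
      (fun hji hi _ => congrArg (fun p => Term.S₂ (tx p) (tx _)) (res_res X hji hi.le p)))
  | .K₁ (p, _) => .inr (lam (fun _ h _ => tx (res X h.le p))
      (fun hji hi _ => congrArg (fun p => tx p) (res_res X hji hi.le p)))
  | .S₂ (p, _) (q, _) => .inr (lam
      (fun _ h t => .app (.app (tx (res X h.le p)) (tx t)) (.app (tx (res X h.le q)) (tx t)))
      (fun hji hi _ => congrArg₂
        (fun p q => Term.app (.app (tx p) (tx _)) (.app (tx q) (tx _)))
        (res_res X hji hi.le p) (res_res X hji hi.le q)))
  | .app (_, .inl U) (q, _) =>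
      .inl (U.map fun u => later₂ (fun _ u q => Term.app (ty u) (tx q)) n u (next X n q))
  | .app (_, .inr f) (q, _) =>
      .inl (Pow.single (later₁ (fun _ u => ty u) n (f.app n le_rfl (next X n q))))
  | .choice (p, _) (q, _) =>
      .inl (Pow.pair (later₁ (fun _ p => tx p) n (next X n p))
        (later₁ (fun _ q => tx q) n (next X n q)))
  | .par (_, .inl U) (_, .inl V) =>
      .inl (Pow.map₂ (later₂ (fun _ u v => Term.par (ty u) (ty v)) n) U V)
  | .par (p, .inr _) (_, .inl V) =>
      .inl (V.map fun v => later₂ (fun _ p v => Term.par (tx p) (ty v)) n (next X n p) v)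
  | .par (_, .inl U) (q, .inr _) =>
      .inl (U.map fun u => later₂ (fun _ u q => Term.par (ty u) (tx q)) n u (next X n q))
  | .par (p, .inr _) (q, .inr _) => .inr (lam
      (fun _ h t => .par (.app (tx (res X h.le p)) (tx t)) (.app (tx (res X h.le q)) (tx t)))
      (fun hji hi _ => congrArg₂
        (fun p q => Term.par (.app (tx p) (tx _)) (.app (tx q) (tx _)))
        (res_res X hji hi.le p) (res_res X hji hi.le q)))

/-- The law of xNCCL at `X`, `Y`, as a morphism of trees. -/
def rhoHom (X Y : Tree) : sigF.obj (prodT X ((Bnc.obj (op X)).obj Y)) ⟶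
    (Bnc.obj (op X)).obj (termF.obj (sumT X Y)) :=
  mkHom (rhoFun X Y) (by
    intro m n h s
    change rhoFun X Y m (Sig.map (Prod.map (res X h)
        (Sum.map (Pow.map (laterRes Y h)) (Exp.restrict h))) s) =
      Sum.map (Pow.map (laterRes (termF.obj (sumT X Y)) h)) (Exp.restrict h) (rhoFun X Y n s)
    rcases s with _ | _ | _ | ⟨p, b⟩ | ⟨p, b⟩ | ⟨⟨p, b⟩, ⟨q, c⟩⟩ | ⟨⟨p, U | f⟩, ⟨q, c⟩⟩ |
      ⟨⟨p, b⟩, ⟨q, c⟩⟩ | ⟨⟨p, U | f⟩, ⟨q, V | g⟩⟩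
    · refine congrArg Sum.inr (Exp.ext ?_)
      funext i hi t
      cases i <;> rfl
    · refine congrArg Sum.inr (Exp.ext ?_)
      funext i hi t
      cases i <;> rfl
    · refine congrArg Sum.inr (Exp.ext ?_)
      funext i hi t
      cases i <;> rfl
    · refine congrArg Sum.inr (Exp.ext ?_)
      funext i hi t
      rcases i with _ | i
      · rfl
      · exact congrArg (fun p => Term.S₂ (tx p) (tx _)) (res_res X _ h p)
    · refine congrArg Sum.inr (Exp.ext ?_)
      funext i hi t
      rcases i with _ | i
      · rfl
      · exact congrArg (fun p => tx p) (res_res X _ h p)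
    · refine congrArg Sum.inr (Exp.ext ?_)
      funext i hi t
      rcases i with _ | i
      · rfl
      · exact congrArg₂ (fun p q => Term.app (.app (tx p) (tx _)) (.app (tx q) (tx _)))
          (res_res X _ h p) (res_res X _ h q)
    · refine congrArg Sum.inl (Pow.map_square (fun u => ?_) _)
      rcases m with _ | m
      · rfl
      · rcases n with _ | n
        · omega
        · exact congrArg (fun q => Term.app (ty _) (tx q))
            ((res_res X _ h q).trans (res_res X _ _ q).symm)
    · refine congrArg Sum.inl ?_
      rw [Pow.map_single]
      congr 1
      rcases m with _ | m
      · rfl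
      · rcases n with _ | n
        · omega
        · refine congrArg ty (((f.nat h le_rfl (next X (n + 1) q)).trans ?_).symm)
          refine congrArg (f.app (m + 1) h) ?_
          exact (res_res X _ _ q).trans (res_res X _ h q).symm
    · refine congrArg Sum.inl ?_
      rw [Pow.map_pair]
      rcases m with _ | m
      · rfl
      · rcases n with _ | n
        · omega
        · exact congrArg₂ (fun p q => Pow.pair (tx p) (tx q))
            ((res_res X _ h p).trans (res_res X _ _ p).symm)
            ((res_res X _ h q).trans (res_res X _ _ q).symm)
    · refine congrArg Sum.inl (Pow.map₂_square (fun u v => ?_) _ _)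
      rcases m with _ | m
      · rfl
      · rcases n with _ | n
        · omega
        · rfl
    · refine congrArg Sum.inl (Pow.map_square (fun u => ?_) _)
      rcases m with _ | m
      · rfl
      · rcases n with _ | n
        · omega
        · exact congrArg (fun q => Term.par (ty _) (tx q))
            ((res_res X _ h q).trans (res_res X _ _ q).symm)
    · refine congrArg Sum.inl (Pow.map_square (fun u => ?_) _)
      rcases m with _ | m
      · rfl
      · rcases n with _ | n
        · omega
        · exact congrArg (fun q => Term.par (tx q) (ty _))
            ((res_res X _ h p).trans (res_res X _ _ p).symm)
    · refine congrArg Sum.inr (Exp.ext ?_)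
      funext i hi t
      rcases i with _ | i
      · rfl
      · exact congrArg₂ (fun p q => Term.par (.app (tx p) (tx _)) (.app (tx q) (tx _)))
          (res_res X _ h p) (res_res X _ h q))

theorem rho_natural (X : Tree) {Y Y' : Tree} (g : Y ⟶ Y') :
    sigF.map (prodMap (𝟙 X) ((Bnc.obj (op X)).map g)) ≫ rhoHom X Y' =
      rhoHom X Y ≫ (Bnc.obj (op X)).map (termF.map (sumMap (𝟙 X) g)) := by
  refine hom_ext fun n s => ?_
  change rhoFun X Y' n (Sig.map (Prod.map id (Sum.map (Pow.map (laterApp g n))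
      (Exp.map (𝟙 _) (later.map g)))) s) =
    Sum.map (Pow.map (laterApp (termF.map (sumMap (𝟙 X) g)) n))
      (Exp.map (𝟙 _) (later.map (termF.map (sumMap (𝟙 X) g)))) (rhoFun X Y n s)
  rcases s with _ | _ | _ | ⟨p, b⟩ | ⟨p, b⟩ | ⟨⟨p, b⟩, ⟨q, c⟩⟩ | ⟨⟨p, U | f⟩, ⟨q, c⟩⟩ |
    ⟨⟨p, b⟩, ⟨q, c⟩⟩ | ⟨⟨p, U | f⟩, ⟨q, V | k⟩⟩
  · refine congrArg Sum.inr (Exp.ext ?_)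
    funext i hi t
    cases i <;> rfl
  · refine congrArg Sum.inr (Exp.ext ?_)
    funext i hi t
    cases i <;> rfl
  · refine congrArg Sum.inr (Exp.ext ?_)
    funext i hi t
    cases i <;> rfl
  · refine congrArg Sum.inr (Exp.ext ?_)
    funext i hi t
    cases i <;> rfl
  · refine congrArg Sum.inr (Exp.ext ?_)
    funext i hi t
    cases i <;> rfl
  · refine congrArg Sum.inr (Exp.ext ?_)
    funext i hi t
    cases i <;> rfl
  · refine congrArg Sum.inl (Pow.map_square (fun u => ?_) _)
    cases n <;> rfl
  · refine congrArg Sum.inl ?_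
    rw [Pow.map_single]
    cases n <;> rfl
  · refine congrArg Sum.inl ?_
    rw [Pow.map_pair]
    cases n <;> rfl
  · refine congrArg Sum.inl (Pow.map₂_square (fun u v => ?_) _ _)
    cases n <;> rfl
  · refine congrArg Sum.inl (Pow.map_square (fun u => ?_) _)
    cases n <;> rfl
  · refine congrArg Sum.inl (Pow.map_square (fun u => ?_) _)
    cases n <;> rfl
  · refine congrArg Sum.inr (Exp.ext ?_)
    funext i hi t
    cases i <;> rfl

theorem rho_dinatural {X X' : Tree} (h : X ⟶ X') (Y : Tree) :
    sigF.map (prodMap (𝟙 X) ((Bnc.map h.op).app Y)) ≫ rhoHom X Y ≫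
        (Bnc.obj (op X)).map (termF.map (sumMap h (𝟙 Y))) =
      sigF.map (prodMap h (𝟙 ((Bnc.obj (op X')).obj Y))) ≫ rhoHom X' Y ≫
        (Bnc.map h.op).app (termF.obj (sumT X' Y)) := by
  refine hom_ext fun n s => ?_
  change Sum.map (Pow.map (laterApp (termF.map (sumMap h (𝟙 Y))) n))
      (Exp.map (𝟙 _) (later.map (termF.map (sumMap h (𝟙 Y)))))
      (rhoFun X Y n (Sig.map (Prod.map id (Sum.map id (Exp.map (later.map h) (𝟙 _)))) s)) =
    Sum.map id (Exp.map (later.map h) (𝟙 _))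
      (rhoFun X' Y n (Sig.map (Prod.map (h.app (op n)) id) s))
  rcases s with _ | _ | _ | ⟨p, b⟩ | ⟨p, b⟩ | ⟨⟨p, b⟩, ⟨q, c⟩⟩ | ⟨⟨p, U | f⟩, ⟨q, c⟩⟩ |
    ⟨⟨p, b⟩, ⟨q, c⟩⟩ | ⟨⟨p, U | f⟩, ⟨q, V | g⟩⟩
  · refine congrArg Sum.inr (Exp.ext ?_)
    funext i hi t
    cases i <;> rfl
  · refine congrArg Sum.inr (Exp.ext ?_)
    funext i hi t
    cases i <;> rfl
  · refine congrArg Sum.inr (Exp.ext ?_)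
    funext i hi t
    cases i <;> rfl
  · refine congrArg Sum.inr (Exp.ext ?_)
    funext i hi t
    rcases i with _ | i
    · rfl
    · exact congrArg (fun p => Term.S₂ (tx p) (tx _)) (app_res h _ p)
  · refine congrArg Sum.inr (Exp.ext ?_)
    funext i hi t
    rcases i with _ | i
    · rfl
    · exact congrArg (fun p => tx p) (app_res h _ p)
  · refine congrArg Sum.inr (Exp.ext ?_)
    funext i hi t
    rcases i with _ | i
    · rfl
    · exact congrArg₂ (fun p q => Term.app (.app (tx p) (tx _)) (.app (tx q) (tx _)))
        (app_res h _ p) (app_res h _ q)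
  · refine congrArg Sum.inl (Pow.map_triangle (fun u => ?_) _)
    rcases n with _ | n
    · rfl
    · exact congrArg (fun q => Term.app (ty _) (tx q)) (app_res h _ q)
  · refine congrArg Sum.inl ?_
    rw [Pow.map_single]
    rcases n with _ | n
    · rfl
    · exact congrArg (fun q => Pow.single (ty (f.app (n + 1) le_rfl q))) (app_res h _ q)
  · refine congrArg Sum.inl ?_
    rw [Pow.map_pair]
    rcases n with _ | n
    · rfl
    · exact congrArg₂ (fun p q => Pow.pair (tx p) (tx q)) (app_res h _ p) (app_res h _ q)
  · refine congrArg Sum.inl (Pow.map₂_triangle (fun u v => ?_) _ _)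
    cases n <;> rfl
  · refine congrArg Sum.inl (Pow.map_triangle (fun u => ?_) _)
    rcases n with _ | n
    · rfl
    · exact congrArg (fun q => Term.par (ty _) (tx q)) (app_res h _ q)
  · refine congrArg Sum.inl (Pow.map_triangle (fun u => ?_) _)
    rcases n with _ | n
    · rfl
    · exact congrArg (fun p => Term.par (tx p) (ty _)) (app_res h _ p)
  · refine congrArg Sum.inr (Exp.ext ?_)
    funext i hi t
    rcases i with _ | i
    · rfl
    · exact congrArg₂ (fun p q => Term.par (.app (tx p) (tx _)) (.app (tx q) (tx _)))
        (app_res h _ p) (app_res h _ q)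

/-- The higher-order GSOS law of xNCCL. -/
def rhoNc : HOGSOSLaw Bnc where
  app := rhoHom
  natural := rho_natural
  dinatural := rho_dinatural

end Rho

/-! ## Step-indexed strong applicative bisimilarity -/

/-- The labelled transitions: `Lab p t p'` states that `p` acts as a function that maps `t`
to `p'`. -/
inductive Lab : Prog → Prog → Prog → Prop
  | S (t : Prog) : Lab .S t (.S₁ t)
  | S₁ (p t : Prog) : Lab (.S₁ p) t (.S₂ p t)
  | S₂ (p q t : Prog) : Lab (.S₂ p q) t (.app (.app p t) (.app q t))
  | K (t : Prog) : Lab .K t (.K₁ t)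
  | K₁ (p t : Prog) : Lab (.K₁ p) t p
  | I (t : Prog) : Lab .I t t
  | par {p q r s p' q' : Prog} (t : Prog) : Lab p r p' → Lab q s q' →
      Lab (.par p q) t (.par (.app p t) (.app q t))

/-- The unlabelled transitions: `Red p p'` states that `p` reduces to `p'`. -/
inductive Red : Prog → Prog → Prop
  | app_red {p p' : Prog} (q : Prog) : Red p p' → Red (.app p q) (.app p' q)
  | app_lab {p q p' : Prog} : Lab p q p' → Red (.app p q) p'
  | choice_left (p q : Prog) : Red (.choice p q) p
  | choice_right (p q : Prog) : Red (.choice p q) q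
  | par_red {p p' q q' : Prog} : Red p p' → Red q q' → Red (.par p q) (.par p' q')
  | par_right {p p' q q' r : Prog} : Lab p r p' → Red q q' → Red (.par p q) (.par p q')
  | par_left {p p' q q' r : Prog} : Red p p' → Lab q r q' → Red (.par p q) (.par p' q)

/-- An `ω`-indexed family of equivalence relations on programs that is a step-indexed strong
applicative bisimulation. -/
structure IsStepBisim (R : ℕ → Prog → Prog → Prop) : Prop where
  equiv : ∀ n, Equivalence (R n)
  mono : ∀ n p q, R (n + 1) p q → R n p q
  red : ∀ n p q p', R (n + 1) p q → Red p p' → ∃ q', Red q q' ∧ R n p' q'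
  lab : ∀ n p q t p', R (n + 1) p q → Lab p t p' → ∃ q', Lab q t q' ∧ R n p' q'

/-- Step-indexed strong applicative bisimilarity, the greatest step-indexed strong applicative
bisimulation. -/
def StepBisim (n : ℕ) (p q : Prog) : Prop := ∃ R, IsStepBisim R ∧ R n p q

theorem stepBisim_isGreatest : IsGreatest {R | IsStepBisim R} StepBisim := by
  have key : IsStepBisim (fun n => Relation.EqvGen (StepBisim n)) := by
    refine ⟨fun n => Relation.EqvGen.is_equivalence _, ?_, ?_, ?_⟩
    · intro n p q h
      refine Relation.EqvGen.mono ?_ _ _ h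
      rintro p q ⟨R, hR, h⟩
      exact ⟨R, hR, hR.mono n p q h⟩
    · intro n p q p' h
      suffices H : (∀ p', Red p p' → ∃ q', Red q q' ∧ Relation.EqvGen (StepBisim n) p' q') ∧
          (∀ q', Red q q' → ∃ p', Red p p' ∧ Relation.EqvGen (StepBisim n) q' p') from H.1 p'
      induction h with
      | rel p q h =>
        obtain ⟨R, hR, h⟩ := h
        constructor
        · intro p' hp
          obtain ⟨q', hq, hr⟩ := hR.red n p q p' h hp
          exact ⟨q', hq, .rel _ _ ⟨R, hR, hr⟩⟩
        · intro q' hq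
          obtain ⟨p', hp, hr⟩ := hR.red n q p q' ((hR.equiv _).symm h) hq
          exact ⟨p', hp, .rel _ _ ⟨R, hR, hr⟩⟩
      | refl p => exact ⟨fun p' hp => ⟨p', hp, .refl _⟩, fun p' hp => ⟨p', hp, .refl _⟩⟩
      | symm p q _ ih => exact ⟨ih.2, ih.1⟩
      | trans p q r _ _ ih ih' =>
        constructor
        · intro p' hp
          obtain ⟨q', hq, h1⟩ := ih.1 p' hp
          obtain ⟨r', hr, h2⟩ := ih'.1 q' hq
          exact ⟨r', hr, .trans _ _ _ h1 h2⟩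
        · intro r' hr
          obtain ⟨q', hq, h1⟩ := ih'.2 r' hr
          obtain ⟨p', hp, h2⟩ := ih.2 q' hq
          exact ⟨p', hp, .trans _ _ _ h1 h2⟩
    · intro n p q t p' h
      suffices H : (∀ p', Lab p t p' → ∃ q', Lab q t q' ∧ Relation.EqvGen (StepBisim n) p' q') ∧
          (∀ q', Lab q t q' → ∃ p', Lab p t p' ∧ Relation.EqvGen (StepBisim n) q' p') from
        H.1 p'
      induction h with
      | rel p q h =>
        obtain ⟨R, hR, h⟩ := h
        constructor
        · intro p' hp
          obtain ⟨q', hq, hr⟩ := hR.lab n p q t p' h hp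
          exact ⟨q', hq, .rel _ _ ⟨R, hR, hr⟩⟩
        · intro q' hq
          obtain ⟨p', hp, hr⟩ := hR.lab n q p t q' ((hR.equiv _).symm h) hq
          exact ⟨p', hp, .rel _ _ ⟨R, hR, hr⟩⟩
      | refl p => exact ⟨fun p' hp => ⟨p', hp, .refl _⟩, fun p' hp => ⟨p', hp, .refl _⟩⟩
      | symm p q _ ih => exact ⟨ih.2, ih.1⟩
      | trans p q r _ _ ih ih' =>
        constructor
        · intro p' hp
          obtain ⟨q', hq, h1⟩ := ih.1 p' hp
          obtain ⟨r', hr, h2⟩ := ih'.1 q' hq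
          exact ⟨r', hr, .trans _ _ _ h1 h2⟩
        · intro r' hr
          obtain ⟨q', hq, h1⟩ := ih'.2 r' hr
          obtain ⟨p', hp, h2⟩ := ih.2 q' hq
          exact ⟨p', hp, .trans _ _ _ h1 h2⟩
  have e : StepBisim = fun n => Relation.EqvGen (StepBisim n) := by
    funext n p q
    exact propext ⟨fun h => .rel _ _ h, fun h => ⟨_, key, h⟩⟩
  refine ⟨?_, fun R hR n p q h => ⟨R, hR, h⟩⟩
  change IsStepBisim StepBisim
  rw [e]
  exact key

end XNCCL

namespace XNCCL

/-! Everything rests on one observation: in `Bnc` both arguments occur only under `▷`, so stage `n`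
of `B(X, Y)` depends only on the stages of `X` and `Y` below `n`. A map known below stage `k`
therefore determines its image under `B` below stage `k + 1` (`PHom.behMap`), and any equation whose
unknown occurs under `B` is contractive. A contractive equation between morphisms has exactly one
solution, built stage by stage (`PHom.existsUnique_fixedPoint`). This is applied three times.

Finality: a coalgebra morphism into a fixed point of `B(X, -)` solves such an equation, so every
fixed point is final (`nonempty_isTerminal_of_iso`). It remains to solve `Z ≅ B(Z, Z)` and `Z ≅ B(X,
Z)`. The iterates of a contractive operation on trees stabilise below stage `k` from the `k`-th one
on, and their stable parts are pasted into a solution (`ContractiveOp.fixIso`).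

Denotational models: for locally final `z`, Lambek's lemma makes `z` invertible. The bialgebra law
becomes an equation for `a` in which `a` on the right evaluates only terms under `B`; it has a
solution (`exists_isDenotationalModel`).

Adequacy: the unknown is now a map out of `μΣ`, and uniqueness of primitive recursion, with
naturality and dinaturality of the law, makes `⟦-⟧` a morphism of `B(μΣ, -)`-coalgebras
(`HOGSOSLaw.sem_comp`). Composed with the map from `Z` to the final coalgebra, it must be `beh`.

Bisimilarity: structural induction shows that a program either has finitely many, and at least one,
reducts, or acts as a function, and that `γ` records exactly this (`isReducing_or_isFunctional`).
Unfolding `beh` once then matches the clauses of bisimilarity. The index shifts by one because `beh`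
separates the two kinds of programs already at stage `0`, where `▷` erases all else. -/

/-! ## Partial morphisms of trees -/

/-- A morphism of trees defined at the stages below `k` only. -/
@[ext]
structure PHom (k : ℕ) (X Y : Tree) where
  app : ∀ n, n < k → X.obj (op n) → Y.obj (op n)
  nat : ∀ {m n : ℕ} (h : m ≤ n) (hn : n < k) (x : X.obj (op n)),
    app m (lt_of_le_of_lt h hn) (res X h x) = res Y h (app n hn x)

namespace PHom

variable {X X' X'' Y Y' Y'' : Tree} {k : ℕ}

/-- The identity at the stages below `k`. -/
def id (k : ℕ) (X : Tree) : PHom k X X := ⟨fun _ _ x => x, fun _ _ _ => rfl⟩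

/-- Composition of partial morphisms. -/
def comp (f : PHom k X X') (g : PHom k X' X'') : PHom k X X'' :=
  ⟨fun n hn x => g.app n hn (f.app n hn x), fun h hn x => by rw [f.nat h hn, g.nat]⟩

/-- The restriction of a morphism to the stages below `k`. -/
def ofHom (k : ℕ) (f : X ⟶ Y) : PHom k X Y :=
  ⟨fun n _ => f.app (op n), fun h _ x => app_res f h x⟩

/-- The restriction of a partial morphism to fewer stages. -/
def trunc {j : ℕ} (h : j ≤ k) (f : PHom k X Y) : PHom j X Y :=
  ⟨fun n hn => f.app n (hn.trans_le h), fun h' hn x => f.nat h' (hn.trans_le h) x⟩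

/-- The partial morphism that is defined nowhere. -/
def empty (X Y : Tree) : PHom 0 X Y :=
  ⟨fun _ hn => absurd hn (Nat.not_lt_zero _), fun _ hn => absurd hn (Nat.not_lt_zero _)⟩

instance : Subsingleton (PHom 0 X Y) :=
  ⟨fun f g => PHom.ext (by funext n hn; exact absurd hn (Nat.not_lt_zero _))⟩

theorem ofHom_comp (f : X ⟶ X') (g : X' ⟶ X'') :
    ofHom k (f ≫ g) = (ofHom k f).comp (ofHom k g) := rfl

theorem ofHom_id : ofHom k (𝟙 X) = id k X := rfl

theorem ofHom_ext {f g : X ⟶ Y} (h : ∀ k, ofHom k f = ofHom k g) : f = g :=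
  hom_ext fun n x => congrArg (fun f : PHom (n + 1) X Y => f.app n n.lt_succ_self x) (h (n + 1))

theorem trunc_family (g : ∀ k, PHom k X Y)
    (hg : ∀ k, (g (k + 1)).trunc (Nat.le_succ k) = g k) {j k : ℕ} (h : j ≤ k) :
    (g k).trunc h = g j := by
  induction h with
  | refl => rfl
  | @step k h ih => rw [← ih, ← hg k]; rfl

/-- A coherent family of partial morphisms defines a morphism. -/
def glue (g : ∀ k, PHom k X Y) (hg : ∀ k, (g (k + 1)).trunc (Nat.le_succ k) = g k) : X ⟶ Y :=
  mkHom (fun n => (g (n + 1)).app n n.lt_succ_self) (fun {m n} h x => by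
    rw [← (g (n + 1)).nat h n.lt_succ_self, ← trunc_family g hg (Nat.succ_le_succ h)]
    rfl)

theorem ofHom_glue (g : ∀ k, PHom k X Y)
    (hg : ∀ k, (g (k + 1)).trunc (Nat.le_succ k) = g k) (k : ℕ) : ofHom k (glue g hg) = g k := by
  refine PHom.ext ?_
  funext n hn
  exact congrArg (fun f : PHom (n + 1) X Y => f.app n n.lt_succ_self)
    (trunc_family g hg (Nat.succ_le_of_lt hn)).symm

/-- The iteration of an operator that extends partial morphisms by one stage. -/
def iter (Φ : ∀ k, PHom k X Y → PHom (k + 1) X Y) : ∀ k, PHom k X Y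
  | 0 => empty X Y
  | k + 1 => Φ k (iter Φ k)

/-- A contractive operator on morphisms has a unique fixed point. -/
theorem existsUnique_fixedPoint (Φ : ∀ k, PHom k X Y → PHom (k + 1) X Y)
    (hΦ : ∀ k f, (Φ (k + 1) f).trunc (Nat.le_succ _) = Φ k (f.trunc (Nat.le_succ k))) :
    ∃! f : X ⟶ Y, ∀ k, ofHom (k + 1) f = Φ k (ofHom k f) := by
  -- The iterates extend one another: by contractivity, truncating `Φ (k + 1)` of an iterate is `Φ
  -- k` of the truncated iterate, so agreement passes from `k` to `k + 1`.
  have hg : ∀ k, (iter Φ (k + 1)).trunc (Nat.le_succ k) = iter Φ k := by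
    intro k
    induction k with
    | zero => exact Subsingleton.elim _ _
    | succ k ih => exact (hΦ k _).trans (congrArg (Φ k) ih)
  refine ⟨glue _ hg, fun k => ?_, fun f hf => ofHom_ext fun k => ?_⟩
  · rw [ofHom_glue, ofHom_glue]; rfl
  -- Two fixed points agree below stage `0` vacuously, and each application of `Φ` gains one stage.
  · rw [ofHom_glue]
    induction k with
    | zero => exact Subsingleton.elim _ _
    | succ k ih => rw [hf, ih]; rfl

/-! ### The later modality and the behaviour functor on partial morphisms -/

/-- The later modality on partial morphisms, at each stage. -/
def laterMap (f : PHom k X Y) : ∀ n, n ≤ k → LaterObj X n → LaterObj Y n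
  | 0, _, _ => PUnit.unit
  | n + 1, hn, x => f.app n hn x

theorem laterMap_res (f : PHom k X Y) : ∀ {m n : ℕ} (h : m ≤ n) (hn : n ≤ k) (x : LaterObj X n),
    f.laterMap m (h.trans hn) (laterRes X h x) = laterRes Y h (f.laterMap n hn x)
  | 0, _, _, _, _ => rfl
  | _ + 1, _ + 1, h, hn, x => f.nat (Nat.le_of_succ_le_succ h) hn x

theorem laterMap_id (n : ℕ) (hn : n ≤ k) (x : LaterObj X n) :
    (id k X).laterMap n hn x = x := by cases n <;> rfl

theorem laterMap_comp (f : PHom k X X') (g : PHom k X' X'') (n : ℕ) (hn : n ≤ k)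
    (x : LaterObj X n) : (f.comp g).laterMap n hn x = g.laterMap n hn (f.laterMap n hn x) := by
  cases n <;> rfl

theorem laterMap_ofHom (f : X ⟶ Y) (n : ℕ) (hn : n ≤ k) (x : LaterObj X n) :
    (ofHom k f).laterMap n hn x = laterApp f n x := by cases n <;> rfl

theorem laterMap_trunc {j : ℕ} (h : j ≤ k) (f : PHom k X Y) (n : ℕ) (hn : n ≤ j)
    (x : LaterObj X n) : (f.trunc h).laterMap n hn x = f.laterMap n (hn.trans h) x := by
  cases n <;> rfl

/-- The action of partial morphisms on exponentials between later objects. -/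
def expMap (a : PHom k X' X) (b : PHom k Y Y') {n : ℕ} (hn : n ≤ k)
    (f : Exp (later.obj X) (later.obj Y) n) : Exp (later.obj X') (later.obj Y') n where
  app i hi x := b.laterMap i (hi.trans hn) (f.app i hi (a.laterMap i (hi.trans hn) x))
  nat hji hi x := by
    refine (b.laterMap_res hji (hi.trans hn) _).symm.trans (congrArg (b.laterMap _ _) ?_)
    refine (f.nat hji hi _).trans (congrArg (f.app _ _) ?_)
    exact (a.laterMap_res hji (hi.trans hn) x).symm

/-- The behaviour bifunctor on partial morphisms; the result is defined at one more stage. -/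
def behMap (a : PHom k X' X) (b : PHom k Y Y') :
    PHom (k + 1) ((Bnc.obj (op X)).obj Y) ((Bnc.obj (op X')).obj Y') where
  app n hn := Sum.map (Pow.map (b.laterMap n (Nat.le_of_lt_succ hn)))
    (expMap a b (Nat.le_of_lt_succ hn))
  nat {m n} h hn x := by
    rcases x with U | f
    · exact congrArg Sum.inl (Pow.map_square
        (fun u => b.laterMap_res h (Nat.le_of_lt_succ hn) u) U)
    · rfl

theorem behMap_id : behMap (id k X) (id k Y) = id (k + 1) ((Bnc.obj (op X)).obj Y) := by
  refine PHom.ext ?_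
  funext n hn x
  rcases x with U | f
  · exact congrArg Sum.inl (Subtype.ext ((Set.image_congr fun u _ => laterMap_id n _ u).trans
      (Set.image_id' _)))
  · refine congrArg Sum.inr (Exp.ext ?_)
    funext i hi x
    exact (laterMap_id i _ _).trans (congrArg (f.app i hi) (laterMap_id i _ _))

theorem behMap_comp (a : PHom k X' X) (a' : PHom k X'' X') (b : PHom k Y Y')
    (b' : PHom k Y' Y'') :
    (behMap a b).comp (behMap a' b') = behMap (a'.comp a) (b.comp b') := by
  refine PHom.ext ?_
  funext n hn x
  rcases x with U | f
  · exact congrArg Sum.inl (Pow.map_triangle (fun u => (laterMap_comp b b' n _ u).symm) U)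
  · refine congrArg Sum.inr (Exp.ext ?_)
    funext i hi x
    refine Eq.trans ?_ (laterMap_comp b b' i _ _).symm
    refine congrArg (b'.laterMap i _) (congrArg (b.laterMap i _) (congrArg (f.app i hi) ?_))
    exact (laterMap_comp a' a i _ _).symm

/-- This is the contractivity hypothesis of `existsUnique_fixedPoint` for operators built from
`behMap`. -/
theorem behMap_trunc (a : PHom (k + 1) X' X) (b : PHom (k + 1) Y Y') :
    (behMap a b).trunc (Nat.le_succ _) =
      behMap (a.trunc (Nat.le_succ k)) (b.trunc (Nat.le_succ k)) := by
  refine PHom.ext ?_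
  funext n hn x
  rcases x with U | f
  · exact congrArg Sum.inl (Subtype.ext (Set.image_congr fun u _ =>
      (laterMap_trunc _ b n _ u).symm))
  · refine congrArg Sum.inr (Exp.ext ?_)
    funext i hi x
    refine Eq.trans ?_ (laterMap_trunc _ b i _ _).symm
    exact congrArg (b.laterMap i _) (congrArg (f.app i hi) (laterMap_trunc _ a i _ _).symm)

/-- Translates between equations of morphisms involving `B(X, -)` and their stagewise
approximations. -/
theorem ofHom_behMap (X : Tree) (g : Y ⟶ Y') :
    ofHom (k + 1) ((Bnc.obj (op X)).map g) = behMap (id k X) (ofHom k g) := by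
  refine PHom.ext ?_
  funext n hn x
  rcases x with U | f
  · exact congrArg Sum.inl (Subtype.ext (Set.image_congr fun u _ =>
      (laterMap_ofHom g n _ u).symm))
  · refine congrArg Sum.inr (Exp.ext ?_)
    funext i hi x
    refine Eq.trans ?_ (laterMap_ofHom g i _ _).symm
    exact congrArg (laterApp g i) (congrArg (f.app i hi) (laterMap_id i _ _).symm)

end PHom

/-! ## Finality of fixed points of the behaviour functor -/

/-- Every fixed point of `B(X, -)` is a final coalgebra. -/
theorem nonempty_isTerminal_of_iso {X Z : Tree} (e : Z ≅ (Bnc.obj (op X)).obj Z) :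
    Nonempty (IsTerminal (⟨Z, e.hom⟩ : Endofunctor.Coalgebra (Bnc.obj (op X)))) := by
  have key : ∀ C : Endofunctor.Coalgebra (Bnc.obj (op X)), ∃! f : C.V ⟶ Z,
      C.str ≫ (Bnc.obj (op X)).map f = f ≫ e.hom := by
    intro C
    -- As `e` is invertible, `f` is a coalgebra morphism iff `f` equals `C.str`, then `B(X, f)`,
    -- then `e.inv`; this is a contractive fixed-point equation.
    have h := PHom.existsUnique_fixedPoint
      (fun k f => ((PHom.ofHom (k + 1) C.str).comp (PHom.behMap (PHom.id k X) f)).comp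
        (PHom.ofHom (k + 1) e.inv))
      (fun k f => by
        refine congrArg (fun g => ((PHom.ofHom (k + 1) C.str).comp g).comp
          (PHom.ofHom (k + 1) e.inv)) (PHom.behMap_trunc _ f))
    refine (existsUnique_congr fun f => ?_).1 h
    rw [← Iso.comp_inv_eq, eq_comm (b := f)]
    constructor
    · intro hf
      refine PHom.ofHom_ext fun k => ?_
      -- The fixed-point equation speaks of the stages below `k + 1`; only those below `k` are
      -- needed here.
      have := congrArg (PHom.trunc (Nat.le_succ k)) (hf k)
      rw [← PHom.ofHom_behMap] at this
      exact this
    · intro hf k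
      rw [← PHom.ofHom_behMap]
      exact congrArg (PHom.ofHom (k + 1)) hf
  exact ⟨IsTerminal.ofUniqueHom (fun C => ⟨(key C).choose, (key C).choose_spec.1⟩)
    (fun C g => Endofunctor.Coalgebra.ext ((key C).choose_spec.2 g.f g.h))⟩

/-! ## Solutions of contractive domain equations -/

/-- An operation on trees that acts functorially on pairs of opposite partial morphisms and turns
agreement below stage `k` into agreement below stage `k + 1`. -/
structure ContractiveOp where
  obj : Tree → Tree
  map : ∀ {k : ℕ} {Y Y' : Tree}, PHom k Y Y' → PHom k Y' Y → PHom (k + 1) (obj Y) (obj Y')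
  map_id : ∀ (k : ℕ) (Y : Tree), map (PHom.id k Y) (PHom.id k Y) = PHom.id (k + 1) (obj Y)
  map_comp : ∀ {k : ℕ} {Y Y' Y'' : Tree} (f : PHom k Y Y') (f' : PHom k Y' Y)
    (g : PHom k Y' Y'') (g' : PHom k Y'' Y'),
    (map f f').comp (map g g') = map (f.comp g) (g'.comp f')
  map_trunc : ∀ {k : ℕ} {Y Y' : Tree} (f : PHom (k + 1) Y Y') (f' : PHom (k + 1) Y' Y),
    (map f f').trunc (Nat.le_succ _) = map (f.trunc (Nat.le_succ k)) (f'.trunc (Nat.le_succ k))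

/-- The operation `Y ↦ B(X, Y)`. -/
def behOp (X : Tree) : ContractiveOp where
  obj Y := (Bnc.obj (op X)).obj Y
  map f _ := PHom.behMap (PHom.id _ X) f
  map_id _ _ := PHom.behMap_id
  map_comp _ _ _ _ := PHom.behMap_comp _ _ _ _
  map_trunc _ _ := PHom.behMap_trunc _ _

/-- The operation `Y ↦ B(Y, Y)`. -/
def behDiagOp : ContractiveOp where
  obj Y := (Bnc.obj (op Y)).obj Y
  map f f' := PHom.behMap f' f
  map_id _ _ := PHom.behMap_id
  map_comp _ _ _ _ := PHom.behMap_comp _ _ _ _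
  map_trunc _ _ := PHom.behMap_trunc _ _

namespace ContractiveOp

variable (F : ContractiveOp)

/-! ### Iterates and their connecting maps -/

/-- The iterates of the operation. -/
def iter : ℕ → Tree
  | 0 => (Functor.const ℕᵒᵖ).obj PUnit
  | k + 1 => F.obj (iter k)

/-- The canonical maps between the stages below `j` of the `k`-th and the `l`-th iterate, where
`j ≤ k` and `j ≤ l`. -/
def conn : ∀ j k l : ℕ, j ≤ k → j ≤ l → PHom j (F.iter k) (F.iter l)
  | 0, _, _, _, _ => PHom.empty _ _
  -- The operation has mixed variance, so a map in the opposite direction is needed as well;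
  -- exchanging `k` and `l` supplies it. Nothing is required at `j = 0`, so the choice of the
  -- initial iterate is immaterial.
  | j + 1, k + 1, l + 1, hk, hl =>
      F.map (conn j k l (Nat.le_of_succ_le_succ hk) (Nat.le_of_succ_le_succ hl))
        (conn j l k (Nat.le_of_succ_le_succ hl) (Nat.le_of_succ_le_succ hk))

theorem conn_self (j k : ℕ) (h : j ≤ k) : F.conn j k k h h = PHom.id j (F.iter k) := by
  induction j generalizing k with
  | zero => exact Subsingleton.elim _ _
  | succ j ih =>
    obtain _ | k := k
    · omega
    · rw [conn, ih, F.map_id]; rfl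

/-- With `conn_self`, this makes the connecting maps mutually inverse: below stage `j`, all iterates
from the `j`-th on are canonically isomorphic. The induction treats both directions at once because
of the mixed variance. -/
theorem conn_comp (j k l m : ℕ) (hk : j ≤ k) (hl : j ≤ l) (hm : j ≤ m) :
    (F.conn j k l hk hl).comp (F.conn j l m hl hm) = F.conn j k m hk hm := by
  induction j generalizing k l m with
  | zero => exact Subsingleton.elim _ _
  | succ j ih =>
    obtain _ | k := k
    · omega
    obtain _ | l := l
    · omega
    obtain _ | m := m
    · omega
    simp only [conn]
    rw [← ih k l m, ← ih m l k]
    exact F.map_comp _ _ _ _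

theorem conn_trunc_succ (j k l : ℕ) (hk : j + 1 ≤ k) (hl : j + 1 ≤ l) :
    (F.conn (j + 1) k l hk hl).trunc (Nat.le_succ j) =
      F.conn j k l (Nat.le_of_succ_le hk) (Nat.le_of_succ_le hl) := by
  induction j generalizing k l with
  | zero => exact Subsingleton.elim _ _
  | succ j ih =>
    obtain _ | k := k
    · omega
    obtain _ | l := l
    · omega
    have h1 := ih k l (Nat.le_of_succ_le_succ hk) (Nat.le_of_succ_le_succ hl)
    have h2 := ih l k (Nat.le_of_succ_le_succ hl) (Nat.le_of_succ_le_succ hk)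
    rw [conn, conn, ← h1, ← h2]
    exact F.map_trunc _ _

theorem conn_trunc {i j : ℕ} (h : i ≤ j) (k l : ℕ) (hk : j ≤ k) (hl : j ≤ l) :
    (F.conn j k l hk hl).trunc h = F.conn i k l (h.trans hk) (h.trans hl) := by
  induction h with
  | refl => rfl
  | @step j h ih =>
    rw [← ih (Nat.le_of_succ_le hk) (Nat.le_of_succ_le hl), ← F.conn_trunc_succ j k l hk hl]
    rfl

/-- The bound `j` does not affect the value at stage `i`; the smallest admissible bound `i + 1`
serves as normal form. -/
theorem conn_app {i j : ℕ} (k l : ℕ) (hk : j ≤ k) (hl : j ≤ l) (hi : i < j)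
    (x : (F.iter k).obj (op i)) :
    (F.conn j k l hk hl).app i hi x =
      (F.conn (i + 1) k l (le_trans hi hk) (le_trans hi hl)).app i i.lt_succ_self x := by
  rw [← F.conn_trunc (Nat.succ_le_of_lt hi) k l hk hl]
  rfl

theorem conn_app_self {i j : ℕ} (k : ℕ) (hk : j ≤ k) (hi : i < j) (x : (F.iter k).obj (op i)) :
    (F.conn j k k hk hk).app i hi x = x := by
  rw [F.conn_self]; rfl

theorem conn_app_app {i j : ℕ} (k l m : ℕ) (hk : j ≤ k) (hl : j ≤ l) (hm : j ≤ m) (hi : i < j)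
    (x : (F.iter k).obj (op i)) :
    (F.conn j l m hl hm).app i hi ((F.conn j k l hk hl).app i hi x) =
      (F.conn j k m hk hm).app i hi x := by
  rw [← F.conn_comp j k l m hk hl hm]; rfl

/-! ### The fixed point as the limit of the stable parts of the iterates -/

/-- The fixed point of the operation: its stage `n` is stage `n` of the iterate `n + 1`. -/
def fix : Tree :=
  mkTree (fun n => (F.iter (n + 1)).obj (op n))
    -- Restriction within iterate `n + 1` ends in the wrong iterate; a connecting map carries the
    -- result to iterate `m + 1`.
    (fun {m n} h x => (F.conn (m + 1) (n + 1) (m + 1) (Nat.succ_le_succ h) le_rfl).app m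
      m.lt_succ_self (res (F.iter (n + 1)) h x))
    (fun {n} x => by rw [res_self, conn_app_self])
    (fun {k m n} h h' x => by
      rw [← PHom.nat, res_res, F.conn_app (j := m + 1) (i := k), conn_app_app])

/-- The canonical map from the fixed point to the iterates. -/
def fixTo (k : ℕ) : PHom k F.fix (F.iter k) where
  app n hn := (F.conn (n + 1) (n + 1) k le_rfl hn).app n n.lt_succ_self
  nat {m n} h hn x := by
    refine (F.conn_app_app _ _ _ _ _ _ _ _).trans ?_
    exact (F.conn_app (j := n + 1) _ _ _ _ _ _).symm.trans (PHom.nat _ h _ _)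

/-- The canonical map from the iterates to the fixed point. -/
def fixFrom (k : ℕ) : PHom k (F.iter k) F.fix where
  app n hn := (F.conn (n + 1) k (n + 1) hn le_rfl).app n n.lt_succ_self
  nat {m n} h hn x := by
    change _ = (F.conn (m + 1) (n + 1) (m + 1) _ _).app m _ (res (F.iter (n + 1)) h _)
    rw [← PHom.nat _ h, F.conn_app (j := n + 1) (i := m), conn_app_app]

theorem fixTo_comp_fixFrom (k : ℕ) : (F.fixTo k).comp (F.fixFrom k) = PHom.id k F.fix := by
  refine PHom.ext ?_
  funext n hn x
  exact (F.conn_app_app _ _ _ _ _ _ _ _).trans (F.conn_app_self _ _ _ _)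

theorem fixFrom_comp_fixTo (k : ℕ) : (F.fixFrom k).comp (F.fixTo k) = PHom.id k (F.iter k) := by
  refine PHom.ext ?_
  funext n hn x
  exact (F.conn_app_app _ _ _ _ _ _ _ _).trans (F.conn_app_self _ _ _ _)

/-- Together with `conn_comp_fixFrom`: the comparison maps for different iterates differ only by
connecting maps. The coherence of the unfoldings and foldings depends on this. -/
theorem fixTo_comp_conn (j k l : ℕ) (hk : j ≤ k) (hl : j ≤ l) :
    ((F.fixTo k).trunc hk).comp (F.conn j k l hk hl) = (F.fixTo l).trunc hl := by
  refine PHom.ext ?_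
  funext n hn x
  exact (F.conn_app _ _ _ _ _ _).trans (F.conn_app_app _ _ _ _ _ _ _ _)

theorem conn_comp_fixFrom (j k l : ℕ) (hk : j ≤ k) (hl : j ≤ l) :
    (F.conn j k l hk hl).comp ((F.fixFrom l).trunc hl) = (F.fixFrom k).trunc hk := by
  refine PHom.ext ?_
  funext n hn x
  refine Eq.trans (congrArg (((F.fixFrom l).trunc hl).app n hn) (F.conn_app _ _ _ _ _ _)) ?_
  exact F.conn_app_app _ _ _ _ _ _ _ _

/-- The unfolding of the fixed point, below stage `k`. -/
def unfold : ∀ k : ℕ, PHom k F.fix (F.obj F.fix)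
  | 0 => PHom.empty _ _
  | k + 1 => (F.fixTo (k + 1)).comp (F.map (F.fixFrom k) (F.fixTo k))

/-- The folding of the fixed point, below stage `k`. -/
def fold : ∀ k : ℕ, PHom k (F.obj F.fix) F.fix
  | 0 => PHom.empty _ _
  | k + 1 => PHom.comp (F.map (F.fixTo k) (F.fixFrom k)) (F.fixFrom (k + 1))

/-- Both arguments of `F.map` on the left factor through a connecting map between the iterates `k +
1` and `k`; functoriality pulls it out, and `F.map` of connecting maps is again a connecting map. -/
theorem map_fixFrom_trunc (k : ℕ) :
    (F.map (F.fixFrom (k + 1)) (F.fixTo (k + 1))).trunc (Nat.le_succ _) =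
      (F.conn (k + 1) (k + 2) (k + 1) (Nat.le_succ _) le_rfl).comp
        (F.map (F.fixFrom k) (F.fixTo k)) := by
  rw [F.map_trunc, ← F.conn_comp_fixFrom k (k + 1) k _ le_rfl,
    ← F.fixTo_comp_conn k k (k + 1) le_rfl _]
  exact (F.map_comp _ _ _ _).symm

theorem map_fixTo_trunc (k : ℕ) :
    (F.map (F.fixTo (k + 1)) (F.fixFrom (k + 1))).trunc (Nat.le_succ _) =
      (F.map (F.fixTo k) (F.fixFrom k)).comp
        (F.conn (k + 1) (k + 1) (k + 2) le_rfl (Nat.le_succ _)) := by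
  rw [F.map_trunc, ← F.conn_comp_fixFrom k (k + 1) k _ le_rfl,
    ← F.fixTo_comp_conn k k (k + 1) le_rfl _]
  exact (F.map_comp _ _ _ _).symm

theorem unfold_trunc (k : ℕ) : (F.unfold (k + 1)).trunc (Nat.le_succ k) = F.unfold k := by
  obtain _ | k := k
  · exact Subsingleton.elim _ _
  · refine (congrArg (PHom.comp ((F.fixTo (k + 2)).trunc (Nat.le_succ _)))
      (F.map_fixFrom_trunc k)).trans ?_
    exact congrArg (fun f => PHom.comp f _)
      (F.fixTo_comp_conn (k + 1) (k + 2) (k + 1) (Nat.le_succ _) le_rfl)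

theorem fold_trunc (k : ℕ) : (F.fold (k + 1)).trunc (Nat.le_succ k) = F.fold k := by
  obtain _ | k := k
  · exact Subsingleton.elim _ _
  · refine (congrArg (fun f => PHom.comp f ((F.fixFrom (k + 2)).trunc (Nat.le_succ _)))
      (F.map_fixTo_trunc k)).trans ?_
    exact congrArg (fun f => PHom.comp _ f)
      (F.conn_comp_fixFrom (k + 1) (k + 1) (k + 2) le_rfl (Nat.le_succ _))

theorem unfold_comp_fold (k : ℕ) : (F.unfold k).comp (F.fold k) = PHom.id k F.fix := by
  obtain _ | k := k
  · exact Subsingleton.elim _ _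
  · change (F.fixTo (k + 1)).comp (((F.map (F.fixFrom k) (F.fixTo k)).comp
      (F.map (F.fixTo k) (F.fixFrom k))).comp (F.fixFrom (k + 1))) = _
    rw [F.map_comp, fixFrom_comp_fixTo, F.map_id]
    exact F.fixTo_comp_fixFrom (k + 1)

theorem fold_comp_unfold (k : ℕ) :
    (F.fold k).comp (F.unfold k) = PHom.id k (F.obj F.fix) := by
  obtain _ | k := k
  · exact Subsingleton.elim _ _
  · change (F.map (F.fixTo k) (F.fixFrom k)).comp (((F.fixFrom (k + 1)).comp
      (F.fixTo (k + 1))).comp (F.map (F.fixFrom k) (F.fixTo k))) = _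
    rw [fixFrom_comp_fixTo]
    refine (F.map_comp _ _ _ _).trans ?_
    rw [fixTo_comp_fixFrom, F.map_id]

/-- The fixed point solves the domain equation `Z ≅ F Z`. -/
def fixIso : F.fix ≅ F.obj F.fix where
  hom := PHom.glue F.unfold F.unfold_trunc
  inv := PHom.glue F.fold F.fold_trunc
  hom_inv_id := PHom.ofHom_ext fun k => by
    rw [PHom.ofHom_comp, PHom.ofHom_id, PHom.ofHom_glue, PHom.ofHom_glue, unfold_comp_fold]
  inv_hom_id := PHom.ofHom_ext fun k => by
    rw [PHom.ofHom_comp, PHom.ofHom_id, PHom.ofHom_glue, PHom.ofHom_glue, fold_comp_unfold]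

end ContractiveOp

/-- A solution of `Z ≅ B(Z, Z)` is in particular a fixed point of `B(Z, -)`, hence final for it. -/
theorem exists_isLocallyFinal :
    ∃ (Z : Tree) (z : Z ⟶ (Bnc.obj (op Z)).obj Z), IsLocallyFinal Bnc Z z :=
  ⟨behDiagOp.fix, behDiagOp.fixIso.hom, nonempty_isTerminal_of_iso behDiagOp.fixIso⟩

theorem exists_isTerminal (X : Tree) :
    ∃ T : Endofunctor.Coalgebra (Bnc.obj (op X)), Nonempty (IsTerminal T) :=
  ⟨_, nonempty_isTerminal_of_iso (behOp X).fixIso⟩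

/-! ## Locally final coalgebras are denotational models -/

/-- Evaluation of terms in a partially defined `Σ`-algebra. -/
def evalP {A : Tree} {k : ℕ} (a : PHom k (sigF.obj A) A) : PHom k (termF.obj A) A where
  app n hn := Term.fold id (a.app n hn)
  nat {m n} h hn t := by
    refine Eq.trans (Term.comp_fold (fun v => Term.var (res A h v)) Term.mk (a.app m _)
      (Term.fold id (a.app m _)) (fun s => Term.fold_mk _ _ s) t) ?_
    exact (Term.comp_fold id (a.app n hn) (a.app m _) (res A h)
      (fun s => (a.nat h hn s).symm) t).symm

/-- After inverting `z`, the bialgebra law reads `a = Φ(a)`, where `Φ` uses `a` only to evaluate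
terms under `B(Z, -)`. Evaluation at a stage needs `a` at that stage only, so `B` makes `Φ`
contractive. -/
theorem exists_isDenotationalModel {Z : Tree} {z : Z ⟶ (Bnc.obj (op Z)).obj Z}
    (hz : IsLocallyFinal Bnc Z z) :
    ∃ a : sigF.obj Z ⟶ Z, rhoNc.IsDenotationalModel Z a z := by
  obtain ⟨hT⟩ := hz
  -- Lambek's lemma: `w` is the inverse of the final coalgebra structure `z`.
  let w : (Bnc.obj (op Z)).obj Z ⟶ Z := Endofunctor.Coalgebra.Terminal.strInv hT
  have hwz : w ≫ z = 𝟙 _ := Endofunctor.Coalgebra.Terminal.left_inv hT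
  let r := sigF.map (FunctorToTypes.prod.lift (𝟙 Z) z) ≫ rhoNc.app Z Z
  let ev (k : ℕ) (a : PHom k (sigF.obj Z) Z) : PHom k (termF.obj (sumT Z Z)) Z :=
    (PHom.ofHom k (termF.map (codiag Z))).comp (evalP a)
  obtain ⟨a, ha, -⟩ := PHom.existsUnique_fixedPoint
    (fun k a => ((PHom.ofHom (k + 1) r).comp (PHom.behMap (PHom.id k Z) (ev k a))).comp
      (PHom.ofHom (k + 1) w))
    (fun k a => congrArg (fun g => ((PHom.ofHom (k + 1) r).comp g).comp
      (PHom.ofHom (k + 1) w)) (PHom.behMap_trunc _ _))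
  refine ⟨a, ?_, ⟨hT⟩⟩
  have h : a = (r ≫ (Bnc.obj (op Z)).map (termF.map (codiag Z) ≫ evalT a)) ≫ w := by
    refine PHom.ofHom_ext fun k => ?_
    have hk : PHom.ofHom (k + 1) a = PHom.ofHom (k + 1)
        ((r ≫ (Bnc.obj (op Z)).map (termF.map (codiag Z) ≫ evalT a)) ≫ w) := by
      rw [PHom.ofHom_comp, PHom.ofHom_comp, PHom.ofHom_behMap]
      exact ha k
    exact congrArg (PHom.trunc (Nat.le_succ k)) hk
  -- Composing the fixed-point equation with `z` cancels `w` and gives the bialgebra law.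
  have h' := congrArg (fun f => f ≫ z) h
  simp only [Category.assoc, hwz, Category.comp_id] at h'
  exact h'.trans (Category.assoc _ _ _)

/-! ## Adequacy -/

theorem evalT_naturality {A A' : Tree} {a : sigF.obj A ⟶ A} {a' : sigF.obj A' ⟶ A'} {f : A ⟶ A'}
    (h : a ≫ f = sigF.map f ≫ a') : evalT a ≫ f = termF.map f ≫ evalT a' := by
  refine hom_ext fun n t => ?_
  have hs (s : Sig (A.obj (op n))) : f.app (op n) (a.app (op n) s) =
      a'.app (op n) (s.map (f.app (op n))) :=
    ConcreteCategory.congr_hom (NatTrans.congr_app h (op n)) s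
  refine (Term.comp_fold id (a.app (op n)) (a'.app (op n)) (f.app (op n)) hs t).trans ?_
  exact (Term.comp_fold (fun v => Term.var (f.app (op n) v)) Term.mk (a'.app (op n))
    (Term.fold id (a'.app (op n))) (fun s => Term.fold_mk _ _ s) t).symm

theorem sem_str {A : Tree} (a : sigF.obj A ⟶ A) :
    muSig.str ≫ sem a = sigF.map (sem a) ≫ a :=
  (muSigInitial.to ⟨A, a⟩).h.symm

namespace HOGSOSLaw

variable {B : Treeᵒᵖ ⥤ Tree ⥤ Tree} (ρ : HOGSOSLaw B)

/-- The denotation map into a bialgebra is a higher-order coalgebra morphism. -/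
theorem sem_comp {Z : Tree} {a : sigF.obj Z ⟶ Z} {z : Z ⟶ (B.obj (op Z)).obj Z}
    (h : ρ.IsBialgebra Z a z) :
    ρ.opModel ≫ (B.obj (op muSig.a)).map (sem a) = sem a ≫ z ≫ (B.map (sem a).op).app Z := by
  -- Both sides satisfy the primitive recursion with this step, which interprets the variables from
  -- `μΣ` by `⟦-⟧` and leaves those from `Z` unchanged.
  let s := ρ.app muSig.a Z ≫ (B.obj (op muSig.a)).map
    (termF.map (sumMap (sem a) (𝟙 Z)) ≫ termF.map (codiag Z) ≫ evalT a)
  refine (primRec_unique s _ ?_).trans (primRec_unique s _ ?_).symm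
  -- Here the law is moved along `⟦-⟧` by naturality in `Y`, and `⟦-⟧` commutes with evaluation as a
  -- `Σ`-algebra morphism.
  · have e1 : sumMap (𝟙 muSig.a) (sem a) ≫ sumMap (sem a) (𝟙 Z) ≫ codiag Z =
        codiag muSig.a ≫ sem a :=
      hom_ext fun n x => by rcases x with x | x <;> rfl
    have e2 : FunctorToTypes.prod.lift (𝟙 muSig.a)
        (ρ.opModel ≫ (B.obj (op muSig.a)).map (sem a)) =
        FunctorToTypes.prod.lift (𝟙 muSig.a) ρ.opModel ≫
          prodMap (𝟙 muSig.a) ((B.obj (op muSig.a)).map (sem a)) := rfl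
    have hb : muSig.str ≫ ρ.opModel = _ := ρ.opModel_isBialgebra
    rw [e2, Functor.map_comp, Category.assoc, ← Category.assoc _ (ρ.app _ _), ρ.natural,
      ← Category.assoc, hb, step, Category.assoc, Category.assoc, Category.assoc,
      ← Functor.map_comp, ← Functor.map_comp, Category.assoc,
      evalT_naturality (sem_str a), ← Functor.map_comp_assoc, ← Functor.map_comp_assoc,
      ← Functor.map_comp_assoc,
      Category.assoc (sumMap (𝟙 muSig.a) (sem a)), e1]
  -- Here the bialgebra law of `Z` is transported to `μΣ` by dinaturality in `X` along `⟦-⟧`.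
  · have e3 : FunctorToTypes.prod.lift (𝟙 muSig.a) (sem a ≫ z ≫ (B.map (sem a).op).app Z) =
        FunctorToTypes.prod.lift (𝟙 muSig.a) (sem a ≫ z) ≫
          prodMap (𝟙 muSig.a) ((B.map (sem a).op).app Z) := rfl
    have e4 : FunctorToTypes.prod.lift (𝟙 muSig.a) (sem a ≫ z) ≫
        prodMap (sem a) (𝟙 ((B.obj (op Z)).obj Z)) =
        sem a ≫ FunctorToTypes.prod.lift (𝟙 Z) z := rfl
    have hd := congrArg (fun f => sigF.map (FunctorToTypes.prod.lift (𝟙 muSig.a) (sem a ≫ z)) ≫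
      f ≫ (B.obj (op muSig.a)).map (termF.map (codiag Z) ≫ evalT a)) (ρ.dinatural (sem a) Z)
    have hb : a ≫ z = _ := h
    rw [← Category.assoc, sem_str, Category.assoc, ← Category.assoc a, hb, e3]
    simp only [Category.assoc] at hd
    rw [← Functor.map_comp_assoc sigF _ (prodMap (sem a) _), e4] at hd
    simp only [step, s, Category.assoc, Functor.map_comp, NatTrans.naturality,
      NatTrans.naturality_assoc] at hd ⊢
    exact hd.symm

/-- Restricting the arguments of `z` along `⟦-⟧` turns `Z` into a `B(μΣ, -)`-coalgebra, and
`sem_comp` makes `⟦-⟧` a morphism into it. The map from there to the final coalgebra is the required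
factor, by uniqueness of `beh`. -/
theorem isAdequate {Z : Tree} {a : sigF.obj Z ⟶ Z} {z : Z ⟶ (B.obj (op Z)).obj Z}
    (h : ρ.IsBialgebra Z a z) : ρ.IsAdequate Z a := by
  intro T hT
  let C : Endofunctor.Coalgebra (B.obj (op muSig.a)) := ⟨Z, z ≫ (B.map (sem a).op).app Z⟩
  let f : ρ.opCoalg ⟶ C := ⟨sem a, ρ.sem_comp h⟩
  exact ⟨(hT.from C).f, congrArg Endofunctor.Coalgebra.Hom.f
    (hT.hom_ext (f ≫ hT.from C) (hT.from ρ.opCoalg))⟩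

end HOGSOSLaw

/-! ## The operational model of xNCCL and the transition relations -/

/-- The evaluation of terms over two copies of `μΣ`. -/
def evalMu : termF.obj (sumT muSig.a muSig.a) ⟶ muSig.a :=
  termF.map (codiag muSig.a) ≫ evalT muSig.str

/-- Stage `n` of the operational model. -/
def opStage (n : ℕ) (p : Prog) :
    Pow (LaterObj muSig.a n) ⊕ Exp (later.obj muSig.a) (later.obj muSig.a) n :=
  rhoNc.opModel.app (op n) p

/-- Stage `n` of a program, under the later modality. -/
def nextProg (n : ℕ) (p : Prog) : LaterObj muSig.a n := next muSig.a n p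

/-- The bialgebra law at a single operator: the operational model of a compound program is one
clause of `rhoFun` followed by evaluation. -/
theorem opStage_mk (n : ℕ) (s : Sig Prog) :
    opStage n (Term.mk s) = Sum.map (Pow.map (laterApp evalMu n))
      (Exp.map (𝟙 _) (later.map evalMu))
      (rhoFun muSig.a muSig.a n (s.map fun p => (p, opStage n p))) := by
  have h := ConcreteCategory.congr_hom (NatTrans.congr_app rhoNc.opModel_isBialgebra (op n)) s
  refine Eq.trans h ?_
  cases s <;> rfl

/-- The tuple of maps given at each stage by one map on programs. -/
def constLam (g : Prog → Prog) (n : ℕ) : Exp (later.obj muSig.a) (later.obj muSig.a) n :=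
  lam (fun _ _ t => g t) (fun _ _ _ => rfl)

/-- `p` is a reducing program with set of reducts `U`. -/
structure IsReducing (p : Prog) (U : Pow Prog) : Prop where
  -- A program with neither reducts nor labelled transitions could not be told apart from a
  -- functional one by the one-sided transition clauses alone; nonemptiness excludes this in
  -- `IsStepBisim.behRel`.
  nonempty : U.1.Nonempty
  mem_iff : ∀ p', p' ∈ U.1 ↔ Red p p'
  not_lab : ∀ t p', ¬ Lab p t p'
  model : ∀ n, opStage n p = .inl (U.map (nextProg n))

/-- `p` is a program that acts as the function `g`. -/
structure IsFunctional (p : Prog) (g : Prog → Prog) : Prop where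
  lab_iff : ∀ t p', Lab p t p' ↔ p' = g t
  not_red : ∀ p', ¬ Red p p'
  model : ∀ n, opStage n p = .inr (constLam g n)

theorem IsFunctional.lab {p : Prog} {g : Prog → Prog} (h : IsFunctional p g) (t : Prog) :
    Lab p t (g t) := (h.lab_iff t _).2 rfl

/-! ### The transition rules against the law, operator by operator -/

theorem isFunctional_S : IsFunctional .S .S₁ where
  lab_iff t p' := ⟨fun h => by cases h; rfl, fun h => h ▸ .S t⟩
  not_red p' h := by cases h
  model n := by
    refine (opStage_mk n .S).trans (congrArg Sum.inr (Exp.ext ?_))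
    funext i hi t
    cases i <;> rfl

theorem isFunctional_K : IsFunctional .K .K₁ where
  lab_iff t p' := ⟨fun h => by cases h; rfl, fun h => h ▸ .K t⟩
  not_red p' h := by cases h
  model n := by
    refine (opStage_mk n .K).trans (congrArg Sum.inr (Exp.ext ?_))
    funext i hi t
    cases i <;> rfl

theorem isFunctional_I : IsFunctional .I id where
  lab_iff t p' := ⟨fun h => by cases h; rfl, fun h => h ▸ .I t⟩
  not_red p' h := by cases h
  model n := by
    refine (opStage_mk n .I).trans (congrArg Sum.inr (Exp.ext ?_))
    funext i hi t
    cases i <;> rfl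

theorem isFunctional_S₁ (p : Prog) : IsFunctional (.S₁ p) (.S₂ p) where
  lab_iff t p' := ⟨fun h => by cases h; rfl, fun h => h ▸ .S₁ p t⟩
  not_red p' h := by cases h
  model n := by
    refine (opStage_mk n (.S₁ p)).trans (congrArg Sum.inr (Exp.ext ?_))
    funext i hi t
    cases i <;> rfl

theorem isFunctional_K₁ (p : Prog) : IsFunctional (.K₁ p) (fun _ => p) where
  lab_iff t p' := ⟨fun h => by cases h; rfl, fun h => h ▸ .K₁ p t⟩
  not_red p' h := by cases h
  model n := by
    refine (opStage_mk n (.K₁ p)).trans (congrArg Sum.inr (Exp.ext ?_))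
    funext i hi t
    cases i <;> rfl

theorem isFunctional_S₂ (p q : Prog) :
    IsFunctional (.S₂ p q) (fun t => .app (.app p t) (.app q t)) where
  lab_iff t p' := ⟨fun h => by cases h; rfl, fun h => h ▸ .S₂ p q t⟩
  not_red p' h := by cases h
  model n := by
    refine (opStage_mk n (.S₂ p q)).trans (congrArg Sum.inr (Exp.ext ?_))
    funext i hi t
    cases i <;> rfl

theorem IsReducing.app {p : Prog} {U : Pow Prog} (h : IsReducing p U) (q : Prog) :
    IsReducing (.app p q) (U.map fun p' => .app p' q) where
  nonempty := h.nonempty.image _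
  mem_iff r := by
    constructor
    · rintro ⟨p', hp, rfl⟩
      exact .app_red q ((h.mem_iff p').1 hp)
    · intro hr
      cases hr with
      | app_red _ hp => exact ⟨_, (h.mem_iff _).2 hp, rfl⟩
      | app_lab hp => exact (h.not_lab _ _ hp).elim
  not_lab t r hr := by cases hr
  model n := by
    refine (opStage_mk n (.app p q)).trans ?_
    change Sum.map _ _ (rhoFun _ _ n (.app (p, opStage n p) (q, opStage n q))) = _
    rw [h.model]
    refine congrArg Sum.inl ?_
    refine Eq.trans (congrArg _ (Pow.map_triangle (fun _ => rfl) U)) ?_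
    refine Pow.map_square (fun u => ?_) U
    cases n <;> rfl

theorem IsFunctional.app {p : Prog} {g : Prog → Prog} (h : IsFunctional p g) (q : Prog) :
    IsReducing (.app p q) (Pow.single (g q)) where
  nonempty := Set.singleton_nonempty _
  mem_iff r := by
    constructor
    · rintro rfl
      exact .app_lab (h.lab q)
    · intro hr
      cases hr with
      | app_red _ hp => exact (h.not_red _ hp).elim
      | app_lab hp => exact (h.lab_iff _ _).1 hp
  not_lab t r hr := by cases hr
  model n := by
    refine (opStage_mk n (.app p q)).trans ?_
    change Sum.map _ _ (rhoFun _ _ n (.app (p, opStage n p) (q, opStage n q))) = _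
    rw [h.model]
    refine congrArg Sum.inl ?_
    refine (Pow.map_single _ _).trans (Eq.trans ?_ (Pow.map_single _ _).symm)
    cases n <;> rfl

theorem isReducing_choice (p q : Prog) : IsReducing (.choice p q) (Pow.pair p q) where
  nonempty := ⟨p, Or.inl rfl⟩
  mem_iff r := by
    constructor
    · rintro (rfl | rfl)
      · exact .choice_left _ _
      · exact .choice_right _ _
    · intro hr
      cases hr with
      | choice_left => exact Or.inl rfl
      | choice_right => exact Or.inr rfl
  not_lab t r hr := by cases hr
  model n := by
    refine (opStage_mk n (.choice p q)).trans (congrArg Sum.inl ?_)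
    refine (Pow.map_pair _ _ _).trans (Eq.trans ?_ (Pow.map_pair _ _ _).symm)
    cases n <;> rfl

theorem IsReducing.par {p q : Prog} {U V : Pow Prog} (h : IsReducing p U)
    (h' : IsReducing q V) : IsReducing (.par p q) (Pow.map₂ .par U V) where
  nonempty := h.nonempty.image2 h'.nonempty
  mem_iff r := by
    constructor
    · rintro ⟨p', hp, q', hq, rfl⟩
      exact .par_red ((h.mem_iff p').1 hp) ((h'.mem_iff q').1 hq)
    · intro hr
      cases hr with
      | par_red hp hq => exact ⟨_, (h.mem_iff _).2 hp, _, (h'.mem_iff _).2 hq, rfl⟩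
      | par_right hp _ => exact (h.not_lab _ _ hp).elim
      | par_left _ hq => exact (h'.not_lab _ _ hq).elim
  not_lab t r hr := by
    cases hr with
    | par _ hp _ => exact h.not_lab _ _ hp
  model n := by
    refine (opStage_mk n (.par p q)).trans ?_
    change Sum.map _ _ (rhoFun _ _ n (.par (p, opStage n p) (q, opStage n q))) = _
    rw [h.model, h'.model]
    refine congrArg Sum.inl ?_
    refine (Pow.map₂_triangle (fun _ _ => rfl) _ _).trans (Pow.map₂_square (fun u v => ?_) U V)
    cases n <;> rfl

theorem IsFunctional.par_isReducing {p q : Prog} {g : Prog → Prog} {V : Pow Prog}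
    (h : IsFunctional p g) (h' : IsReducing q V) :
    IsReducing (.par p q) (V.map fun q' => .par p q') where
  nonempty := h'.nonempty.image _
  mem_iff r := by
    constructor
    · rintro ⟨q', hq, rfl⟩
      -- The rule asks for some labelled transition of `p`; the label is arbitrary, and `p` itself
      -- is at hand.
      exact .par_right (h.lab p) ((h'.mem_iff q').1 hq)
    · intro hr
      cases hr with
      | par_red hp hq => exact (h.not_red _ hp).elim
      | par_right _ hq => exact ⟨_, (h'.mem_iff _).2 hq, rfl⟩
      | par_left hp _ => exact (h.not_red _ hp).elim
  not_lab t r hr := by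
    cases hr with
    | par _ _ hq => exact h'.not_lab _ _ hq
  model n := by
    refine (opStage_mk n (.par p q)).trans ?_
    change Sum.map _ _ (rhoFun _ _ n (.par (p, opStage n p) (q, opStage n q))) = _
    rw [h.model, h'.model]
    refine congrArg Sum.inl ?_
    refine Eq.trans (congrArg _ (Pow.map_triangle (fun _ => rfl) V)) ?_
    refine Pow.map_square (fun u => ?_) V
    cases n <;> rfl

theorem IsReducing.par_isFunctional {p q : Prog} {g : Prog → Prog} {U : Pow Prog}
    (h : IsReducing p U) (h' : IsFunctional q g) :
    IsReducing (.par p q) (U.map fun p' => .par p' q) where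
  nonempty := h.nonempty.image _
  mem_iff r := by
    constructor
    · rintro ⟨p', hp, rfl⟩
      exact .par_left ((h.mem_iff p').1 hp) (h'.lab q)
    · intro hr
      cases hr with
      | par_red _ hq => exact (h'.not_red _ hq).elim
      | par_right _ hq => exact (h'.not_red _ hq).elim
      | par_left hp _ => exact ⟨_, (h.mem_iff _).2 hp, rfl⟩
  not_lab t r hr := by
    cases hr with
    | par _ hp _ => exact h.not_lab _ _ hp
  model n := by
    refine (opStage_mk n (.par p q)).trans ?_
    change Sum.map _ _ (rhoFun _ _ n (.par (p, opStage n p) (q, opStage n q))) = _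
    rw [h.model, h'.model]
    refine congrArg Sum.inl ?_
    refine Eq.trans (congrArg _ (Pow.map_triangle (fun _ => rfl) U)) ?_
    refine Pow.map_square (fun u => ?_) U
    cases n <;> rfl

theorem IsFunctional.par {p q : Prog} {f g : Prog → Prog} (h : IsFunctional p f)
    (h' : IsFunctional q g) :
    IsFunctional (.par p q) (fun t => .par (.app p t) (.app q t)) where
  lab_iff t r := by
    constructor
    · intro hr
      cases hr
      rfl
    · rintro rfl
      exact .par t (h.lab t) (h'.lab t)
  not_red r hr := by
    cases hr with
    | par_red hp _ => exact h.not_red _ hp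
    | par_right _ hq => exact h'.not_red _ hq
    | par_left hp _ => exact h.not_red _ hp
  model n := by
    refine (opStage_mk n (.par p q)).trans ?_
    change Sum.map _ _ (rhoFun _ _ n (.par (p, opStage n p) (q, opStage n q))) = _
    rw [h.model, h'.model]
    refine congrArg Sum.inr (Exp.ext ?_)
    funext i hi t
    cases i <;> rfl

/-- Every program either reduces or acts as a function, and the operational model records which. -/
theorem isReducing_or_isFunctional (p : Prog) :
    (∃ U, IsReducing p U) ∨ ∃ g, IsFunctional p g := by
  induction p with
  | var v => exact v.elim
  | S => exact .inr ⟨_, isFunctional_S⟩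
  | K => exact .inr ⟨_, isFunctional_K⟩
  | I => exact .inr ⟨_, isFunctional_I⟩
  | S₁ p => exact .inr ⟨_, isFunctional_S₁ p⟩
  | K₁ p => exact .inr ⟨_, isFunctional_K₁ p⟩
  | S₂ p q => exact .inr ⟨_, isFunctional_S₂ p q⟩
  | app p q ih =>
    obtain ⟨U, h⟩ | ⟨g, h⟩ := ih
    · exact .inl ⟨_, h.app q⟩
    · exact .inl ⟨_, h.app q⟩
  | choice p q => exact .inl ⟨_, isReducing_choice p q⟩
  | par p q ih ih' =>
    obtain ⟨U, h⟩ | ⟨f, h⟩ := ih <;> obtain ⟨V, h'⟩ | ⟨g, h'⟩ := ih'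
    · exact .inl ⟨_, h.par h'⟩
    · exact .inl ⟨_, h.par_isFunctional h'⟩
    · exact .inl ⟨_, h.par_isReducing h'⟩
    · exact .inr ⟨_, h.par h'⟩

/-! ## Behavioural equivalence is step-indexed bisimilarity -/

section Behaviour

variable {T : Endofunctor.Coalgebra (Bnc.obj (op muSig.a))} (hT : IsTerminal T)

/-- Stage `n` of the behaviour of a program. -/
def behStage (n : ℕ) (p : Prog) : T.V.obj (op n) := (rhoNc.beh hT).app (op n) p

/-- The behaviour of a program under the later modality. -/
def laterBeh (n : ℕ) (p : Prog) : LaterObj T.V n :=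
  laterApp (rhoNc.beh hT) n (nextProg n p)

/-- The structure of a final coalgebra is injective by Lambek's lemma, so behaviours can be compared
after one unfolding. -/
theorem behStage_eq_iff (n : ℕ) (p q : Prog) :
    behStage hT n p = behStage hT n q ↔
      Sum.map (Pow.map (laterApp (rhoNc.beh hT) n)) (Exp.map (𝟙 _) (later.map (rhoNc.beh hT)))
          (opStage n p) =
        Sum.map (Pow.map (laterApp (rhoNc.beh hT) n)) (Exp.map (𝟙 _) (later.map (rhoNc.beh hT)))
          (opStage n q) := by
  have h (p : Prog) : Sum.map (Pow.map (laterApp (rhoNc.beh hT) n))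
      (Exp.map (𝟙 _) (later.map (rhoNc.beh hT))) (opStage n p) =
      T.str.app (op n) (behStage hT n p) :=
    ConcreteCategory.congr_hom (NatTrans.congr_app (hT.from rhoNc.opCoalg).h (op n)) p
  have hinj : Function.Injective (T.str.app (op n)) :=
    Function.LeftInverse.injective
      (g := (Endofunctor.Coalgebra.Terminal.strInv hT).app (op n)) fun x =>
        ConcreteCategory.congr_hom
          (NatTrans.congr_app (Endofunctor.Coalgebra.Terminal.right_inv hT) (op n)) x
  rw [h, h]
  exact hinj.eq_iff.symm

theorem behStage_eq_of_le {m n : ℕ} (h : m ≤ n) {p q : Prog}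
    (hpq : behStage hT n p = behStage hT n q) : behStage hT m p = behStage hT m q :=
  (app_res (rhoNc.beh hT) h p).trans
    ((congrArg (res T.V h) hpq).trans (app_res (rhoNc.beh hT) h q).symm)

theorem behStage_eq_iff_of_isReducing {n : ℕ} {p q : Prog} {U V : Pow Prog}
    (hp : IsReducing p U) (hq : IsReducing q V) :
    behStage hT n p = behStage hT n q ↔ laterBeh hT n '' U.1 = laterBeh hT n '' V.1 := by
  have h (U : Pow Prog) : Pow.map (laterApp (rhoNc.beh hT) n) (U.map (nextProg n)) =
      U.map (laterBeh hT n) := Pow.map_triangle (fun _ => rfl) U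
  rw [behStage_eq_iff, hp.model, hq.model, Sum.map_inl, Sum.map_inl, Sum.inl.injEq, h, h,
    Subtype.ext_iff]
  rfl

/-- The two kinds of programs land in different summands of `B`, and this is visible at every stage,
including `0`. -/
theorem behStage_ne {n : ℕ} {p q : Prog} {U : Pow Prog} {g : Prog → Prog}
    (hp : IsReducing p U) (hq : IsFunctional q g) : behStage hT n p ≠ behStage hT n q := by
  rw [Ne, behStage_eq_iff, hp.model, hq.model]
  exact Sum.inl_ne_inr

/-- Component `j + 1` of the exponential compares results at stage `j`; component `0` takes values
in a point and carries no information. -/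
theorem behStage_eq_iff_of_isFunctional {n : ℕ} {p q : Prog} {f g : Prog → Prog}
    (hp : IsFunctional p f) (hq : IsFunctional q g) :
    behStage hT n p = behStage hT n q ↔
      ∀ j < n, ∀ t, behStage hT j (f t) = behStage hT j (g t) := by
  rw [behStage_eq_iff, hp.model, hq.model, Sum.map_inr, Sum.map_inr, Sum.inr.injEq]
  constructor
  · intro h j hj t
    exact congrFun (congrFun (congrFun (congrArg Exp.app h) (j + 1)) hj) t
  · intro h
    refine Exp.ext ?_
    funext i hi t
    obtain _ | j := i
    · rfl
    · exact h j hi t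

/-- The step-indexed relation that relates everything at stage `0` and programs with the same
behaviour at stage `n` at stage `n + 1`. -/
def BehRel : ℕ → Prog → Prog → Prop
  | 0, _, _ => True
  | n + 1, p, q => behStage hT n p = behStage hT n q

/-- `BehRel` is the kernel of `beh` under `▷`, the form in which reducts are compared inside `B`. -/
theorem behRel_iff (n : ℕ) (p q : Prog) :
    BehRel hT n p q ↔ laterBeh hT n p = laterBeh hT n q := by
  obtain _ | n := n
  · exact iff_of_true trivial rfl
  · rfl

theorem isStepBisim_behRel : IsStepBisim (BehRel hT) where
  equiv n := by
    obtain _ | n := n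
    · exact ⟨fun _ => trivial, fun _ => trivial, fun _ _ => trivial⟩
    · exact ⟨fun _ => rfl, Eq.symm, Eq.trans⟩
  mono n p q h := by
    obtain _ | n := n
    · trivial
    · exact behStage_eq_of_le hT n.le_succ h
  red n p q p' h hr := by
    change behStage hT n p = behStage hT n q at h
    obtain ⟨U, hp⟩ | ⟨f, hp⟩ := isReducing_or_isFunctional p
    · obtain ⟨V, hq⟩ | ⟨g, hq⟩ := isReducing_or_isFunctional q
      · rw [behStage_eq_iff_of_isReducing hT hp hq] at h
        obtain ⟨q', hq', e⟩ : laterBeh hT n p' ∈ laterBeh hT n '' V.1 :=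
          h ▸ Set.mem_image_of_mem _ ((hp.mem_iff p').2 hr)
        exact ⟨q', (hq.mem_iff q').1 hq', (behRel_iff hT n p' q').2 e.symm⟩
      · exact (behStage_ne hT hp hq h).elim
    · exact (hp.not_red _ hr).elim
  lab n p q t p' h hl := by
    change behStage hT n p = behStage hT n q at h
    obtain ⟨U, hp⟩ | ⟨f, hp⟩ := isReducing_or_isFunctional p
    · exact (hp.not_lab _ _ hl).elim
    · obtain ⟨V, hq⟩ | ⟨g, hq⟩ := isReducing_or_isFunctional q
      · exact (behStage_ne hT hq hp h.symm).elim
      · rw [behStage_eq_iff_of_isFunctional hT hp hq] at h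
        refine ⟨g t, hq.lab t, ?_⟩
        rw [(hp.lab_iff t p').1 hl]
        obtain _ | n := n
        · trivial
        · exact h n n.lt_succ_self t

theorem IsStepBisim.mono_le {R : ℕ → Prog → Prog → Prop} (hR : IsStepBisim R) {m n : ℕ}
    (h : m ≤ n) {p q : Prog} (hpq : R n p q) : R m p q := by
  induction h with
  | refl => exact hpq
  | step _ ih => exact ih (hR.mono _ _ _ hpq)

/-- Strong induction is needed because equality of functional behaviours at stage `n` involves
results at all stages `j < n`, not just the previous one; `mono_le` lowers the index of `R`
accordingly. -/
theorem IsStepBisim.behRel {R : ℕ → Prog → Prog → Prop} (hR : IsStepBisim R) (n : ℕ) {p q : Prog}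
    (h : R n p q) : BehRel hT n p q := by
  induction n using Nat.strong_induction_on generalizing p q with
  | h n ih =>
  obtain _ | n := n
  · trivial
  change behStage hT n p = behStage hT n q
  obtain ⟨U, hp⟩ | ⟨f, hp⟩ := isReducing_or_isFunctional p <;>
    obtain ⟨V, hq⟩ | ⟨g, hq⟩ := isReducing_or_isFunctional q
  · rw [behStage_eq_iff_of_isReducing hT hp hq]
    have key {p q : Prog} {U V : Pow Prog} (hp : IsReducing p U) (hq : IsReducing q V)
        (h : R (n + 1) p q) : laterBeh hT n '' U.1 ⊆ laterBeh hT n '' V.1 := by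
      rintro _ ⟨p', hp', rfl⟩
      obtain ⟨q', hq', hr⟩ := hR.red n p q p' h ((hp.mem_iff p').1 hp')
      exact ⟨q', (hq.mem_iff q').2 hq',
        ((behRel_iff hT n p' q').1 (ih n n.lt_succ_self hr)).symm⟩
    exact (key hp hq h).antisymm (key hq hp ((hR.equiv _).symm h))
  -- A reducing program has a reduct, which a functional program cannot match.
  · obtain ⟨p', hp'⟩ := hp.nonempty
    obtain ⟨q', hq', -⟩ := hR.red n p q p' h ((hp.mem_iff p').1 hp')
    exact (hq.not_red _ hq').elim
  -- Symmetrically, a functional program accepts every label, here `p`, and a reducing one accepts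
  -- none.
  · obtain ⟨p', hp', -⟩ := hR.lab n p q p (f p) h (hp.lab p)
    exact (hq.not_lab _ _ hp').elim
  · rw [behStage_eq_iff_of_isFunctional hT hp hq]
    intro j hj t
    obtain ⟨q', hq', hr⟩ := hR.lab n p q t (f t) h (hp.lab t)
    rw [(hq.lab_iff t q').1 hq'] at hr
    exact ih (j + 1) (Nat.succ_lt_succ hj) (hR.mono_le hj hr)

theorem behStage_eq_iff_stepBisim (n : ℕ) (p q : Prog) :
    behStage hT n p = behStage hT n q ↔ StepBisim (n + 1) p q :=
  ⟨fun h => ⟨_, isStepBisim_behRel hT, h⟩, fun ⟨_, hR, h⟩ => hR.behRel hT (n + 1) h⟩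

end Behaviour

/-- `BehEquiv` quantifies over all final coalgebras, so the direction towards bisimilarity needs one
to exist. -/
theorem behEquiv_iff_stepBisim (p q : Prog) (n : ℕ) :
    rhoNc.BehEquiv n p q ↔ StepBisim (n + 1) p q := by
  obtain ⟨T, ⟨hT⟩⟩ := exists_isTerminal muSig.a
  exact ⟨fun h => (behStage_eq_iff_stepBisim hT n p q).1 (h T hT),
    fun h T hT => (behStage_eq_iff_stepBisim hT n p q).2 h⟩

/-- An adequate algebra identifies only behaviourally equivalent programs. -/
theorem HOGSOSLaw.IsAdequate.behEquiv {B : Treeᵒᵖ ⥤ Tree ⥤ Tree} {ρ : HOGSOSLaw B} {A : Tree}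
    {a : sigF.obj A ⟶ A} (h : ρ.IsAdequate A a) {p q : Prog} {n : ℕ}
    (hpq : (sem a).app (op n) p = (sem a).app (op n) q) : ρ.BehEquiv n p q := by
  intro T hT
  obtain ⟨e, he⟩ := h T hT
  rw [← he]
  exact congrArg (e.app (op n)) hpq

end XNCCL

/-- Denotational model for xNCCL. -/
theorem mainTheorem8 :
    -- the behaviour bifunctor has a locally final coalgebra, and every `B(X, -)` a final one
    (∃ (Z : XNCCL.Tree) (z : Z ⟶ (XNCCL.Bnc.obj (op Z)).obj Z),
      XNCCL.IsLocallyFinal XNCCL.Bnc Z z) ∧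
    (∀ X : XNCCL.Tree, ∃ T : Endofunctor.Coalgebra (XNCCL.Bnc.obj (op X)),
      Nonempty (IsTerminal T)) ∧
    -- every locally final coalgebra extends to a denotational model
    (∀ (Z : XNCCL.Tree) (z : Z ⟶ (XNCCL.Bnc.obj (op Z)).obj Z),
      XNCCL.IsLocallyFinal XNCCL.Bnc Z z →
        ∃ a : XNCCL.sigF.obj Z ⟶ Z, XNCCL.rhoNc.IsDenotationalModel Z a z) ∧
    -- every denotational model is adequate
    (∀ (Z : XNCCL.Tree) (a : XNCCL.sigF.obj Z ⟶ Z) (z : Z ⟶ (XNCCL.Bnc.obj (op Z)).obj Z),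
      XNCCL.rhoNc.IsDenotationalModel Z a z →
        XNCCL.rhoNc.IsAdequate Z a ∧
        ∀ (p q : XNCCL.Prog) (n : ℕ),
          (XNCCL.sem a).app (op n) p = (XNCCL.sem a).app (op n) q →
            XNCCL.rhoNc.BehEquiv n p q ∧ XNCCL.StepBisim n p q) ∧
    -- behavioural equivalence is the explicit bisimilarity, with the index shifted by one
    (∀ (p q : XNCCL.Prog) (n : ℕ),
      XNCCL.rhoNc.BehEquiv n p q ↔ XNCCL.StepBisim (n + 1) p q) := by
  refine ⟨XNCCL.exists_isLocallyFinal, XNCCL.exists_isTerminal,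
    fun Z z hz => XNCCL.exists_isDenotationalModel hz, fun Z a z h => ?_,
    XNCCL.behEquiv_iff_stepBisim⟩
  have had := XNCCL.rhoNc.isAdequate h.1
  refine ⟨had, fun p q n hpq => ?_⟩
  have hb := had.behEquiv hpq
  -- This bisimilarity has index `n + 1`; monotonicity brings it down to `n`.
  obtain ⟨R, hR, hr⟩ := (XNCCL.behEquiv_iff_stepBisim p q n).1 hb
  exact ⟨hb, R, hR, hR.mono n p q hr⟩
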